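/- Let $d,m\ge 1$, $\Gamma_n^d=[-n,n]^d\cap\mathbb Z^d$. For each $n$ let $(\varepsilon_{n,i})_{i\in\mathbb Z^d}$ be i.i.d. real random variables with mean $0$ and finite variance $\sigma^2$ (not depending on $n$). Assume that there are constants $H_0,C_0>0$ such that, for all $n,i$, $\mathbb E e^{z\varepsilon_{n,i}}$ exists for $|z|<H_0$ ($z\in\mathbb C$), and the cumulant generating function $L_n(z)=\log \mathbb E e^{z\varepsilon_{n,i}}$ (principal logarithm) is analytic with $|L_n(z)|<C_0$ in this disc. Let $(a_i)_{i\in\mathbb Z^d}$ be real with $\sum_i a_i^2<\infty$ and let $X_{n,j}=\sum_{i\in\mathbb Z^d}a_i\varepsilon_{n,j-i}$ (convergent in $L^2$). Consider $$Y_{n,j}=g(z_{n,j})+X_{n,j},\qquad j\in\Gamma_n^d,$$ where $g:\mathbb R^m\to\mathbb R$ is bounded and continuous and the design points $z_{n,j}$ lie in a fixed compact subset of $\mathbb R^m$. For a kernel $K:\mathbb R^m\to[0,\infty)$ and bandwidths $h_n>0$, $h_n\to0$, let $$g_n(z)=\sum_{j\in\Gamma_n^d}w_{n,j}(z)Y_{n,j},\qquad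 w_{n,j}(z)=\frac{K((z-z_{n,j})/h_n)}{\sum_{i\in\Gamma_n^d}K((z-z_{n,i})/h_n)}$$ (with $w_{n,j}(z)=0$ if the denominator vanishes, which under the assumptions below happens for at most finitely many $n$). Fix $z\in\mathbb R^m$ and put $b_{n,j}(z)=\sum_{i\in\Gamma_n^d}w_{n,i}(z)a_{i-j}$, $B_n(z)=\sigma^2\sum_{j\in\mathbb Z^d}b_{n,j}(z)^2$, $M_n(z)=\max_{j\in\mathbb Z^d}|b_{n,j}(z)|$. Let $H_n>0$ satisfy $H_n\propto M_n(z)^{-1}$, i.e. $H_n/M_n(z)^{-1}$ converges to a positive constant, and suppose $B_n(z)H_n^2\to\infty$. Then there are power series $\lambda_n(t)=\sum_{k\ge0}\beta_{kn}t^k$, whose coefficients $(\beta_{kn})_k$ are a function of $H_n$ and of the cumulants of the variables $b_{n,j}(z)\varepsilon_{n,j}$, $j\in\mathbb Z^d$, only (for each $d$, one and the same function for all models and all $n$), and which for some $\rho>0$ converge and are bounded uniformly in $n$ on $|t|<\rho$, such that for every sequence $x=x_n\ge0$ with $x=o(H_n\sqrt{B_n(z)})$, as $n\to\infty$, $$P\big(g_n(z)-\mathbb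 E g_n(z)>x\sqrt{B_n(z)}\big)=(1-\Phi(x))\exp\Big\{\frac{x^3}{H_n\sqrt{B_n(z)}}\lambda_n\Big(\frac{x}{H_n\sqrt{B_n(z)}}\Big)\Big\}\Big(1+O\Big(\frac{x+1}{H_n\sqrt{B_n(z)}}\Big)\Big),$$ where $\Phi$ is the standard normal distribution function, and the constant in $O(\cdot)$ does not depend on the sequence $x$. -/

import Mathlib

open MeasureTheory ProbabilityTheory Filter Topology Asymptotics

noncomputable section

namespace KernelRegression

/-- The box `[-n, n]^d ∩ ℤ^d`. -/
def box (d n : ℕ) : Finset (Fin d → ℤ) :=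
  Finset.Icc (fun _ => -(n : ℤ)) (fun _ => (n : ℤ))

/-- `a n ∝ b n`: the ratio converges to a positive constant. -/
def IsPropTo (a b : ℕ → ℝ) : Prop :=
  ∃ c : ℝ, 0 < c ∧ Tendsto (fun n => a n / b n) atTop (𝓝 c)

/-- The cumulant generating function `L(z) = log E exp(z X)` of a complex argument,
with the principal value of the logarithm. -/
def complexCGF {Ω : Type*} [MeasurableSpace Ω] (X : Ω → ℝ) (μ : Measure Ω) (z : ℂ) : ℂ :=
  Complex.log (complexMGF X μ z)

/-- `L` exists and is analytic in the disc `|z| < H`, where `|L(z)| < C`. -/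
structure CramerCondition {Ω : Type*} [MeasurableSpace Ω] (X : Ω → ℝ) (μ : Measure Ω)
    (H C : ℝ) : Prop where
  integrable : ∀ z ∈ Metric.ball (0 : ℂ) H,
    Integrable (fun ω => Complex.exp (z * (X ω : ℂ))) μ
  analytic : AnalyticOnNhd ℂ (complexCGF X μ) (Metric.ball (0 : ℂ) H)
  bound : ∀ z ∈ Metric.ball (0 : ℂ) H, ‖complexCGF X μ z‖ < C

/-- The cumulant of order `k`: the `k`-th derivative at `0` of `t ↦ log E exp(t X)`. -/
def cumulant {Ω : Type*} [MeasurableSpace Ω] (X : Ω → ℝ) (μ : Measure Ω) (k : ℕ) : ℝ :=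
  iteratedDeriv k (cgf X μ) 0

/-- The linear random field `X_j = ∑_{i ∈ ℤ^d} a_i ε_{j-i}`, the series being summed in `L²`. -/
def linearField {d : ℕ} {Ω : Type*} [MeasurableSpace Ω] (μ : Measure Ω)
    (a : (Fin d → ℤ) → ℝ) (ε : (Fin d → ℤ) → Ω → ℝ) (hε : ∀ i, MemLp (ε i) 2 μ)
    (j : Fin d → ℤ) : Ω → ℝ :=
  ((∑' i : Fin d → ℤ, a i • (hε (j - i)).toLp (ε (j - i)) : Lp ℝ 2 μ) : Ω → ℝ)

/-- The kernel weights `w_{n,j}(z) = K((z - z_{n,j})/h_n) / ∑_{i ∈ [-n,n]^d} K((z - z_{n,i})/h_n)`,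
for design points `pt n j = z_{n,j}` and bandwidths `h`. -/
def weight {d m : ℕ} (K : EuclideanSpace ℝ (Fin m) → ℝ) (h : ℕ → ℝ)
    (pt : ℕ → (Fin d → ℤ) → EuclideanSpace ℝ (Fin m)) (n : ℕ) (j : Fin d → ℤ)
    (z : EuclideanSpace ℝ (Fin m)) : ℝ :=
  K ((h n)⁻¹ • (z - pt n j)) / ∑ i ∈ box d n, K ((h n)⁻¹ • (z - pt n i))

/-- The kernel estimator `g_n(z) = ∑_{j ∈ [-n,n]^d} w_{n,j}(z) Y_{n,j}`. -/
def estimator {d m : ℕ} {Ω : Type*} (K : EuclideanSpace ℝ (Fin m) → ℝ) (h : ℕ → ℝ)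
    (pt : ℕ → (Fin d → ℤ) → EuclideanSpace ℝ (Fin m)) (Y : ℕ → (Fin d → ℤ) → Ω → ℝ)
    (n : ℕ) (z : EuclideanSpace ℝ (Fin m)) (ω : Ω) : ℝ :=
  ∑ j ∈ box d n, weight K h pt n j z * Y n j ω

/-- `b_{n,j}(z) = ∑_{i ∈ [-n,n]^d} w_{n,i}(z) a_{i-j}`. -/
def coeff {d m : ℕ} (K : EuclideanSpace ℝ (Fin m) → ℝ) (h : ℕ → ℝ)
    (pt : ℕ → (Fin d → ℤ) → EuclideanSpace ℝ (Fin m)) (a : (Fin d → ℤ) → ℝ)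
    (n : ℕ) (j : Fin d → ℤ) (z : EuclideanSpace ℝ (Fin m)) : ℝ :=
  ∑ i ∈ box d n, weight K h pt n i z * a (i - j)

/-- `B_n(z) = σ² ∑_{j ∈ ℤ^d} b_{n,j}(z)²`. -/
def varB {d m : ℕ} (K : EuclideanSpace ℝ (Fin m) → ℝ) (h : ℕ → ℝ)
    (pt : ℕ → (Fin d → ℤ) → EuclideanSpace ℝ (Fin m)) (a : (Fin d → ℤ) → ℝ) (σ : ℝ)
    (n : ℕ) (z : EuclideanSpace ℝ (Fin m)) : ℝ :=
  σ ^ 2 * ∑' j : Fin d → ℤ, coeff K h pt a n j z ^ 2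

/-- `M_n(z) = max_{j ∈ ℤ^d} |b_{n,j}(z)|`. -/
def maxM {d m : ℕ} (K : EuclideanSpace ℝ (Fin m) → ℝ) (h : ℕ → ℝ)
    (pt : ℕ → (Fin d → ℤ) → EuclideanSpace ℝ (Fin m)) (a : (Fin d → ℤ) → ℝ)
    (n : ℕ) (z : EuclideanSpace ℝ (Fin m)) : ℝ :=
  ⨆ j : Fin d → ℤ, |coeff K h pt a n j z|

/-- The standard normal distribution function. -/
def stdNormalCDF (x : ℝ) : ℝ := cdf (gaussianReal 0 1) x

end KernelRegression

end

/-! This is Cramér's method, carried out uniformly in `n`. The centred estimator is almost surely an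
`L²` sum `S = ∑ b_j ε_j`. With `V = H² B` and `y = x / (H √B)`, the event in question is `H S > y
V`, and `y √V = x`. Since `H M` is bounded, the coefficients `H b_j` are bounded by a fixed `c₀`.
The estimate `|H b_j| ^ k ≤ c₀ ^ (k - 2) (H b_j)²` then bounds every cumulant of `H S` by `V` times
a quantity that does not depend on `n`. Hence the cumulant generating function of `H S` is `V φ` on
a fixed disc, with `φ(u) = u² / 2 + ⋯` and uniform control of `φ''`. All analysis takes place in the
class `IsNormalizedCGF φ R A`, with constants that depend on `R` and `A` only.

For such a `φ` let `s` solve `φ'(s) = y`. Tilting the law by `exp (s u)` moves its mean to `y V` and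
gives the exact formula `P(H S > y V) = exp (V (φ(s) - s y)) E[exp (-s W); W > 0]`, where `W` is the
centred tilted variable. The exponent is `-V φ*(y)` with `φ*` the Legendre transform, and `φ*(y) =
y² / 2 - y³ λ(y)` produces both `exp (-x² / 2)` and the Cramér series (`exists_cramerSeries`).
Esseen's inequality (`abs_cdf_sub_cdf_le`) puts `W` within `O(1 / √V)` of a Gaussian of variance `V
φ''(s)`, so the expectation is a value of the Mills ratio up to `O(1 / √V)`. Its argument `s √(V
φ''(s))` differs from `x` by a relative error `O(y)`, and the lower bound `mills x ≥ const / (1 +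
x)` turns the absolute error into a relative one of order `(1 + x) / √V`
(`exists_cramer_expansion`).

The coefficients of `λ` are Taylor coefficients of the Legendre transform. They depend only on the
germ of `φ` at `0`, hence only on `H` and the cumulants of the summands, which gives one function
for all models. -/

noncomputable section

namespace KernelRegression

/-! ### The Fejér kernel -/

/-- The Fejér kernel `2 (1 - cos x) / x²`, up to normalization. -/
def fejer (x : ℝ) : ℝ := Real.sinc (x / 2) ^ 2

lemma continuous_fejer : Continuous fejer := by
  unfold fejer; fun_prop

lemma fejer_nonneg (x : ℝ) : 0 ≤ fejer x := sq_nonneg _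

lemma fejer_le_one (x : ℝ) : fejer x ≤ 1 := by
  unfold fejer
  exact (sq_le_one_iff_abs_le_one _).2 (Real.abs_sinc_le_one _)

lemma fejer_neg (x : ℝ) : fejer (-x) = fejer x := by
  simp [fejer, neg_div, Real.sinc_neg]

lemma sq_mul_fejer (x : ℝ) : x ^ 2 * fejer x = 2 * (1 - Real.cos x) := by
  rcases eq_or_ne x 0 with rfl | hx
  · simp
  · have h2 : Real.cos x = 1 - 2 * Real.sin (x / 2) ^ 2 := by
      have := Real.cos_two_mul (x / 2)
      have h3 := Real.sin_sq_add_cos_sq (x / 2)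
      rw [show 2 * (x / 2) = x by ring] at this
      linarith
    rw [fejer, Real.sinc_of_ne_zero (by positivity), h2]
    field_simp
    ring

lemma sq_mul_fejer_le (x : ℝ) : x ^ 2 * fejer x ≤ 4 := by
  rw [sq_mul_fejer]
  linarith [Real.neg_one_le_cos x]

lemma integrable_fejer : Integrable fejer := by
  refine Integrable.mono' (integrable_inv_one_add_sq.const_mul 5)
    continuous_fejer.aestronglyMeasurable (ae_of_all _ fun x => ?_)
  rw [Real.norm_of_nonneg (fejer_nonneg x), ← div_eq_mul_inv, le_div_iff₀ (by positivity)]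
  nlinarith [sq_mul_fejer_le x, fejer_le_one x]

lemma integral_fejer_pos : 0 < ∫ x, fejer x := by
  refine integral_pos_of_integrable_nonneg_nonzero (x := 0) continuous_fejer integrable_fejer
    fejer_nonneg ?_
  simp [fejer]

lemma setIntegral_fejer_Ioi_le {h : ℝ} (hh : 0 < h) : ∫ x in Set.Ioi h, fejer x ≤ 4 / h := by
  have h1 : IntegrableOn (fun x : ℝ => 4 * x ^ (-2 : ℝ)) (Set.Ioi h) :=
    (integrableOn_Ioi_rpow_of_lt (by norm_num) hh).const_mul 4
  have h2 : ∫ x in Set.Ioi h, 4 * x ^ (-2 : ℝ) = 4 / h := by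
    rw [integral_const_mul, integral_Ioi_rpow_of_lt (by norm_num) hh]
    norm_num [Real.rpow_neg_one]
    ring
  rw [← h2]
  refine setIntegral_mono_on integrable_fejer.integrableOn h1 measurableSet_Ioi fun x hx => ?_
  have hx0 : 0 < x := hh.trans hx
  rw [Real.rpow_neg hx0.le, ← div_eq_mul_inv, le_div_iff₀ (by positivity)]
  have := sq_mul_fejer_le x
  rw [Real.rpow_two]; linarith

lemma setIntegral_fejer_tail_le {h : ℝ} (hh : 0 < h) :
    ∫ x in (Set.Icc (-h) h)ᶜ, fejer x ≤ 8 / h := by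
  have h1 : (Set.Icc (-h) h)ᶜ = Set.Iio (-h) ∪ Set.Ioi h := by
    ext x; simp only [Set.mem_compl_iff, Set.mem_Icc, not_and_or, not_le, Set.mem_union,
      Set.mem_Iio, Set.mem_Ioi]
  have h2 : ∫ x in Set.Iio (-h), fejer x = ∫ x in Set.Ioi h, fejer x := by
    rw [← integral_Iic_eq_integral_Iio, ← integral_comp_neg_Ioi]
    simp [fejer_neg]
  rw [h1, setIntegral_union _ measurableSet_Ioi integrable_fejer.integrableOn
    integrable_fejer.integrableOn, h2]
  · have := setIntegral_fejer_Ioi_le hh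
    calc _ ≤ 4 / h + 4 / h := add_le_add this this
      _ = 8 / h := by ring
  · rw [Set.disjoint_left]
    intro x hx hx'
    simp only [Set.mem_Iio, Set.mem_Ioi] at hx hx'
    linarith

/-- The kernel is the Fourier transform of a function supported in `[-1, 1]`. Smoothing with it
therefore only involves characteristic functions on that interval, the only place where they can be
controlled. -/
lemma integral_triangle_mul_cos (x : ℝ) :
    ∫ t in (-1 : ℝ)..1, (1 - |t|) * Real.cos (t * x) = fejer x := by
  have hint : ∀ a b : ℝ, IntervalIntegrable (fun t : ℝ => (1 - |t|) * Real.cos (t * x)) volume a b :=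
    fun a b => Continuous.intervalIntegrable (by fun_prop) a b
  have h01 : ∫ t in (0 : ℝ)..1, (1 - |t|) * Real.cos (t * x)
      = ∫ t in (0 : ℝ)..1, (1 - t) * Real.cos (t * x) := by
    refine intervalIntegral.integral_congr fun t ht => ?_
    rw [Set.uIcc_of_le zero_le_one] at ht
    simp [abs_of_nonneg ht.1]
  have hsym : ∫ t in (-1 : ℝ)..0, (1 - |t|) * Real.cos (t * x)
      = ∫ t in (0 : ℝ)..1, (1 - |t|) * Real.cos (t * x) := by
    have := intervalIntegral.integral_comp_neg (a := (0 : ℝ)) (b := 1)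
      (fun t => (1 - |t|) * Real.cos (t * x))
    simpa using this.symm
  rw [← intervalIntegral.integral_add_adjacent_intervals (hint (-1) 0) (hint 0 1), hsym, h01]
  rcases eq_or_ne x 0 with rfl | hx
  · have : ∫ t in (0 : ℝ)..1, (1 - t) * Real.cos (t * 0) = 1 / 2 := by
      simp only [mul_zero, Real.cos_zero, mul_one]
      rw [intervalIntegral.integral_sub (by simp) (by simp)]
      simp; norm_num
    rw [this]; simp [fejer]; norm_num
  · have hd : ∀ t ∈ Set.uIcc (0 : ℝ) 1, HasDerivAt
        (fun t : ℝ => (1 - t) * (Real.sin (t * x) / x) - Real.cos (t * x) / x ^ 2)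
        ((1 - t) * Real.cos (t * x)) t := by
      intro t _
      have h1 : HasDerivAt (fun t : ℝ => t * x) x t := by
        simpa using (hasDerivAt_id t).mul_const x
      have h2 := ((hasDerivAt_id t).const_sub 1).mul (h1.sin.div_const x)
      have h3 := h2.sub (h1.cos.div_const (x ^ 2))
      convert! h3 using 1
      simp only [id]
      field_simp
      ring
    rw [intervalIntegral.integral_eq_sub_of_hasDerivAt hd
      (Continuous.intervalIntegrable (by fun_prop) _ _)]
    have hf : fejer x = 2 * (1 - Real.cos x) / x ^ 2 := by
      rw [← sq_mul_fejer]; field_simp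
    rw [hf]
    simp
    field_simp
    ring

/-! ### Smoothing of distribution functions -/

section Smoothing

variable (ν : Measure ℝ)

lemma integral_fejer_sub [IsProbabilityMeasure ν] (r : ℝ) :
    ∫ z, fejer (r - z) ∂ν
      = ∫ t in (-1 : ℝ)..1, (1 - |t|) * (Complex.exp (t * r * Complex.I) * charFun ν (-t)).re := by
  have h1 : ∀ z, fejer (r - z) = ∫ t in (-1 : ℝ)..1, (1 - |t|) * Real.cos (t * (r - z)) :=
    fun z => (integral_triangle_mul_cos _).symm
  simp_rw [h1, intervalIntegral.integral_of_le (show (-1 : ℝ) ≤ 1 by norm_num)]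
  rw [integral_integral_swap]
  · refine integral_congr_ae (ae_of_all _ fun t => ?_)
    simp only
    rw [integral_const_mul, charFun_apply_real]
    congr 1
    rw [← integral_const_mul]
    have hexp : ∀ z : ℝ, Complex.exp (t * r * Complex.I) * Complex.exp (((-t : ℝ) : ℂ) * z * Complex.I)
        = Complex.exp (((t * (r - z) : ℝ) : ℂ) * Complex.I) := by
      intro z
      rw [← Complex.exp_add]
      congr 1
      push_cast; ring
    have hint : Integrable (fun z : ℝ => Complex.exp (((t * (r - z) : ℝ) : ℂ) * Complex.I)) ν :=
      Integrable.of_bound (C := 1) (by fun_prop)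
        (ae_of_all _ fun z => (Complex.norm_exp_ofReal_mul_I _).le)
    simp_rw [hexp]
    refine Eq.trans ?_ (integral_re (𝕜 := ℂ) hint)
    refine integral_congr_ae (ae_of_all _ fun z => ?_)
    exact (Complex.exp_ofReal_mul_I_re _).symm
  · refine Integrable.of_bound (C := 2)
      (Continuous.aestronglyMeasurable (by fun_prop)) ?_
    rw [Measure.ae_prod_iff_ae_ae (measurableSet_le (by fun_prop) (by fun_prop))]
    refine ae_of_all _ fun z => ?_
    filter_upwards [ae_restrict_mem measurableSet_Ioc] with t ht
    simp only [Function.uncurry]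
    rw [norm_mul, Real.norm_eq_abs, Real.norm_eq_abs]
    have h2 : |t| ≤ 1 := abs_le.2 ⟨ht.1.le, ht.2⟩
    have h3 : abs (1 - |t|) ≤ 2 := by
      rw [abs_le]; constructor <;> linarith [abs_nonneg t]
    nlinarith [Real.abs_cos_le_one (t * (r - z)), abs_nonneg (Real.cos (t * (r - z)))]

lemma integrable_cdf_mul_fejer (x : ℝ) : Integrable (fun s => cdf ν (x - s) * fejer s) := by
  refine integrable_fejer.bdd_mul (c := 1) ?_ (ae_of_all _ fun s => ?_)
  · exact ((monotone_cdf ν).measurable.comp (measurable_const.sub measurable_id)).aestronglyMeasurable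
  · rw [Real.norm_of_nonneg (cdf_nonneg _ _)]; exact cdf_le_one _ _

lemma integral_cdf_mul_fejer [IsProbabilityMeasure ν] (x : ℝ) :
    ∫ s, cdf ν (x - s) * fejer s = ∫ z, (∫ s in Set.Iic (x - z), fejer s) ∂ν := by
  have h1 : ∀ s, cdf ν (x - s) * fejer s
      = ∫ z, (Set.Iic (x - s)).indicator (fun _ => fejer s) z ∂ν := by
    intro s
    rw [integral_indicator measurableSet_Iic, setIntegral_const, cdf_eq_real, smul_eq_mul]
  have h2 : ∀ z, ∫ s in Set.Iic (x - z), fejer s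
      = ∫ s, (Set.Iic (x - s)).indicator (fun _ => fejer s) z := by
    intro z
    rw [← integral_indicator measurableSet_Iic]
    congr 1 with s
    simp only [Set.indicator, Set.mem_Iic]
    congr 1
    exact propext ⟨fun h => by linarith, fun h => by linarith⟩
  simp_rw [h1, h2]
  rw [integral_integral_swap]
  refine Integrable.mono (g := fun p : ℝ × ℝ => fejer p.1) ?_ ?_ (ae_of_all _ fun p => ?_)
  · exact integrable_fejer.comp_fst ν
  · have : (Function.uncurry fun s z => (Set.Iic (x - s)).indicator (fun _ => fejer s) z)
        = {p : ℝ × ℝ | p.2 ≤ x - p.1}.indicator (fun p => fejer p.1) := by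
      ext p; simp [Set.indicator, Function.uncurry]
    rw [this]
    refine (Measurable.indicator ?_ ?_).aestronglyMeasurable
    · exact continuous_fejer.measurable.comp measurable_fst
    · exact measurableSet_le measurable_snd (measurable_const.sub measurable_fst)
  · simp only [Function.uncurry, Set.indicator]
    split_ifs <;> simp

/-- The smoothed distribution function has the smoothed measure as its density; this is the
integrated form, obtained by Fubini. -/
lemma integral_cdf_mul_fejer_sub [IsProbabilityMeasure ν] {a b : ℝ} (hab : a ≤ b) :
    (∫ s, cdf ν (b - s) * fejer s) - ∫ s, cdf ν (a - s) * fejer s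
      = ∫ r in a..b, ∫ z, fejer (r - z) ∂ν := by
  have hQ : ∀ x, Integrable (fun z => ∫ s in Set.Iic (x - z), fejer s) ν := by
    intro x
    refine Integrable.of_bound (C := ∫ s, fejer s) ?_ (ae_of_all _ fun z => ?_)
    · have : Monotone (fun c => ∫ s in Set.Iic c, fejer s) := by
        intro c c' hc
        exact setIntegral_mono_set integrable_fejer.integrableOn
          (ae_of_all _ fejer_nonneg) (Set.Iic_subset_Iic.2 hc).eventuallyLE
      exact (this.measurable.comp (measurable_const.sub measurable_id)).aestronglyMeasurable
    · rw [Real.norm_of_nonneg (integral_nonneg fejer_nonneg)]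
      exact setIntegral_le_integral integrable_fejer (ae_of_all _ fejer_nonneg)
  rw [integral_cdf_mul_fejer, integral_cdf_mul_fejer, ← integral_sub (hQ b) (hQ a)]
  have h1 : ∀ z, (∫ s in Set.Iic (b - z), fejer s) - ∫ s in Set.Iic (a - z), fejer s
      = ∫ r in a..b, fejer (r - z) := by
    intro z
    rw [intervalIntegral.integral_Iic_sub_Iic integrable_fejer.integrableOn
      integrable_fejer.integrableOn, intervalIntegral.integral_comp_sub_right fejer z]
  simp_rw [h1, intervalIntegral.integral_of_le hab]
  rw [integral_integral_swap]
  refine Integrable.of_bound (C := 1) (Continuous.aestronglyMeasurable ?_) (ae_of_all _ fun p => ?_)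
  · exact continuous_fejer.comp (continuous_snd.sub continuous_fst)
  · simp only [Function.uncurry]
    rw [Real.norm_of_nonneg (fejer_nonneg _)]
    exact fejer_le_one _

lemma tendsto_integral_cdf_mul_fejer_atBot :
    Tendsto (fun a => ∫ s, cdf ν (a - s) * fejer s) atBot (𝓝 0) := by
  have : Tendsto (fun a => ∫ s, cdf ν (a - s) * fejer s) atBot (𝓝 (∫ _s : ℝ, (0 : ℝ))) := by
    refine tendsto_integral_filter_of_dominated_convergence fejer ?_ ?_ integrable_fejer ?_
    · exact Eventually.of_forall fun a => (integrable_cdf_mul_fejer ν a).aestronglyMeasurable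
    · refine Eventually.of_forall fun a => ae_of_all _ fun s => ?_
      rw [norm_mul, Real.norm_of_nonneg (cdf_nonneg _ _), Real.norm_of_nonneg (fejer_nonneg _)]
      exact mul_le_of_le_one_left (fejer_nonneg _) (cdf_le_one _ _)
    · refine ae_of_all _ fun s => ?_
      have := ((tendsto_cdf_atBot ν).comp (tendsto_atBot_add_const_right _ (-s) tendsto_id)).mul_const
        (fejer s)
      simpa [sub_eq_add_neg] using this
  simpa using this

lemma norm_integral_exp_mul_I_le {t : ℝ} (ht : t ≠ 0) (a b : ℝ) :
    ‖∫ r in a..b, Complex.exp (t * r * Complex.I)‖ ≤ 2 / |t| := by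
  have h1 : ∀ r : ℝ, Complex.exp (t * r * Complex.I) = Complex.exp ((t * Complex.I) * r) := by
    intro r; congr 1; ring
  have hc : (t : ℂ) * Complex.I ≠ 0 := by simp [ht]
  simp_rw [h1]
  rw [integral_exp_mul_complex hc, norm_div]
  have h2 : ‖(t : ℂ) * Complex.I‖ = |t| := by simp
  rw [h2]
  gcongr
  refine (norm_sub_le _ _).trans ?_
  have h3 : ∀ r : ℝ, ‖Complex.exp ((t * Complex.I) * r)‖ = 1 := by
    intro r
    rw [← h1, ← Complex.ofReal_mul, Complex.norm_exp_ofReal_mul_I]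
  rw [h3, h3]; norm_num

/-- Fourier inversion over a bounded range `[a, b]`: integrating `exp (i t r)` over `r` costs `2 /
|t|`, which the factor `|t|` in the hypothesis absorbs. Working with increments avoids any singular
integral at `t = 0`. -/
lemma abs_integral_cdf_sub_le [IsProbabilityMeasure ν] (γ : Measure ℝ) [IsProbabilityMeasure γ]
    {G : ℝ → ℝ} (hG : Continuous G)
    (h : ∀ t ∈ Set.Icc (-1 : ℝ) 1, ‖charFun ν (-t) - charFun γ (-t)‖ ≤ |t| * G t)
    {a b : ℝ} (hab : a ≤ b) :
    |(∫ s, (cdf ν (b - s) - cdf γ (b - s)) * fejer s)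
      - ∫ s, (cdf ν (a - s) - cdf γ (a - s)) * fejer s| ≤ 2 * ∫ t in (-1 : ℝ)..1, G t := by
  set δ : ℝ → ℂ := fun t => charFun ν (-t) - charFun γ (-t) with hδ
  have hcν : Continuous fun t => charFun ν (-t) := continuous_charFun.comp continuous_neg
  have hcγ : Continuous fun t => charFun γ (-t) := continuous_charFun.comp continuous_neg
  have hcδ : Continuous δ := hcν.sub hcγ
  have hsplit : ∀ x, ∫ s, (cdf ν (x - s) - cdf γ (x - s)) * fejer s
      = (∫ s, cdf ν (x - s) * fejer s) - ∫ s, cdf γ (x - s) * fejer s := by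
    intro x
    rw [← integral_sub (integrable_cdf_mul_fejer ν x) (integrable_cdf_mul_fejer γ x)]
    congr 1 with s; ring
  have hfub : (∫ s, (cdf ν (b - s) - cdf γ (b - s)) * fejer s)
      - ∫ s, (cdf ν (a - s) - cdf γ (a - s)) * fejer s
      = ∫ t in (-1 : ℝ)..1, (1 - |t|) * (δ t * ∫ r in a..b, Complex.exp (t * r * Complex.I)).re := by
    rw [hsplit, hsplit, sub_sub_sub_comm, integral_cdf_mul_fejer_sub ν hab,
      integral_cdf_mul_fejer_sub γ hab]
    simp_rw [integral_fejer_sub]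
    rw [← intervalIntegral.integral_sub]
    rotate_left
    · refine Continuous.intervalIntegrable ?_ _ _
      refine intervalIntegral.continuous_parametric_intervalIntegral_of_continuous' ?_ _ _
      exact (by fun_prop : Continuous fun p : ℝ × ℝ => 1 - |p.2|).mul
        (Complex.continuous_re.comp ((by fun_prop : Continuous fun p : ℝ × ℝ =>
          Complex.exp (p.2 * p.1 * Complex.I)).mul (hcν.comp continuous_snd)))
    · refine Continuous.intervalIntegrable ?_ _ _
      refine intervalIntegral.continuous_parametric_intervalIntegral_of_continuous' ?_ _ _
      exact (by fun_prop : Continuous fun p : ℝ × ℝ => 1 - |p.2|).mul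
        (Complex.continuous_re.comp ((by fun_prop : Continuous fun p : ℝ × ℝ =>
          Complex.exp (p.2 * p.1 * Complex.I)).mul (hcγ.comp continuous_snd)))
    have h1 : ∀ r : ℝ, ((∫ t in (-1 : ℝ)..1, (1 - |t|) * (Complex.exp (t * r * Complex.I) * charFun ν (-t)).re)
        - ∫ t in (-1 : ℝ)..1, (1 - |t|) * (Complex.exp (t * r * Complex.I) * charFun γ (-t)).re)
        = ∫ t in (-1 : ℝ)..1, (1 - |t|) * (δ t * Complex.exp (t * r * Complex.I)).re := by
      intro r
      rw [← intervalIntegral.integral_sub]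
      · refine intervalIntegral.integral_congr fun t _ => ?_
        simp only [hδ]
        rw [← mul_sub, ← Complex.sub_re, ← mul_sub, mul_comm (Complex.exp _)]
      · exact Continuous.intervalIntegrable (by fun_prop) _ _
      · exact Continuous.intervalIntegrable (by fun_prop) _ _
    simp_rw [h1, intervalIntegral.integral_of_le hab,
      intervalIntegral.integral_of_le (show (-1 : ℝ) ≤ 1 by norm_num)]
    rw [integral_integral_swap]
    · refine integral_congr_ae (ae_of_all _ fun t => ?_)
      simp only
      rw [integral_const_mul]
      congr 1
      rw [← integral_const_mul]
      have hint : Integrable (fun r : ℝ => δ t * Complex.exp (t * r * Complex.I))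
          (volume.restrict (Set.Ioc a b)) :=
        (Continuous.integrableOn_Icc (by fun_prop)).mono_set Set.Ioc_subset_Icc_self
      exact integral_re (𝕜 := ℂ) hint
    · rw [Measure.prod_restrict]
      refine (ContinuousOn.integrableOn_compact (isCompact_Icc.prod isCompact_Icc)
        (Continuous.continuousOn ?_)).mono_set
          (Set.prod_mono Set.Ioc_subset_Icc_self Set.Ioc_subset_Icc_self)
      exact (by fun_prop : Continuous fun p : ℝ × ℝ => 1 - |p.2|).mul
        (Complex.continuous_re.comp ((hcδ.comp continuous_snd).mul (by fun_prop : Continuous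
          fun p : ℝ × ℝ => Complex.exp (p.2 * p.1 * Complex.I))))
  rw [hfub, ← intervalIntegral.integral_const_mul, ← Real.norm_eq_abs]
  refine intervalIntegral.norm_integral_le_of_norm_le (by norm_num) (ae_of_all _ fun t ht => ?_)
    ((hG.const_mul 2).intervalIntegrable _ _)
  have ht' : t ∈ Set.Icc (-1 : ℝ) 1 := Set.Ioc_subset_Icc_self ht
  have htabs : |t| ≤ 1 := abs_le.2 ⟨ht'.1, ht'.2⟩
  have h1 : ‖δ t‖ ≤ |t| * G t := h t ht'
  -- At `t = 0` one cannot divide by `|t|`, and only `0 ≤ G 0` is needed; it follows from the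
  -- hypothesis at small `t > 0` and continuity.
  rcases eq_or_ne t 0 with rfl | h0
  · have hδ0 : δ 0 = 0 := by simp [hδ]
    have : 0 ≤ G 0 := by
      by_contra hneg
      push Not at hneg
      have h2 : ∀ᶠ t in 𝓝 (0 : ℝ), G t < 0 := hG.continuousAt.eventually (gt_mem_nhds hneg)
      have h3 : ∀ᶠ t in 𝓝 (0 : ℝ), t ∈ Set.Icc (-1 : ℝ) 1 := Icc_mem_nhds (by norm_num) (by norm_num)
      obtain ⟨ε, hε, hball⟩ := Metric.eventually_nhds_iff.1 (h2.and h3)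
      have h4 := hball (y := ε / 2) (by simp [abs_of_pos hε]; linarith)
      have h5 := h _ h4.2
      have h6 : |ε / 2| * G (ε / 2) < 0 := mul_neg_of_pos_of_neg (by positivity) h4.1
      linarith [norm_nonneg (charFun ν (-(ε / 2)) - charFun γ (-(ε / 2)))]
    simp [hδ0, this]
  · have hpos : 0 < |t| := abs_pos.2 h0
    rw [norm_mul, Real.norm_eq_abs, Real.norm_eq_abs]
    have h2 : abs (1 - |t|) ≤ 1 := by
      rw [abs_le]; constructor <;> linarith
    have h3 : |(δ t * ∫ r in a..b, Complex.exp (t * r * Complex.I)).re| ≤ 2 * G t := by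
      refine (Complex.abs_re_le_norm _).trans ?_
      rw [norm_mul]
      calc _ ≤ (|t| * G t) * (2 / |t|) :=
            mul_le_mul h1 (norm_integral_exp_mul_I_le h0 a b) (norm_nonneg _)
              ((norm_nonneg _).trans h1)
        _ = 2 * G t := by field_simp
    calc _ ≤ 1 * (2 * G t) := mul_le_mul h2 h3 (abs_nonneg _) zero_le_one
      _ = _ := one_mul _

/-- The bound on increments does not depend on `a`, so let `a → -∞`, where both smoothed
distribution functions vanish. -/
lemma abs_integral_cdf_le [IsProbabilityMeasure ν] (γ : Measure ℝ) [IsProbabilityMeasure γ]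
    {G : ℝ → ℝ} (hG : Continuous G)
    (h : ∀ t ∈ Set.Icc (-1 : ℝ) 1, ‖charFun ν (-t) - charFun γ (-t)‖ ≤ |t| * G t) (b : ℝ) :
    |∫ s, (cdf ν (b - s) - cdf γ (b - s)) * fejer s| ≤ 2 * ∫ t in (-1 : ℝ)..1, G t := by
  have h1 : Tendsto (fun a => ∫ s, (cdf ν (a - s) - cdf γ (a - s)) * fejer s) atBot (𝓝 0) := by
    have := (tendsto_integral_cdf_mul_fejer_atBot ν).sub (tendsto_integral_cdf_mul_fejer_atBot γ)
    rw [sub_zero] at this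
    refine this.congr fun x => ?_
    rw [← integral_sub (integrable_cdf_mul_fejer ν x) (integrable_cdf_mul_fejer γ x)]
    congr 1 with s; ring
  have h2 := (h1.const_sub (∫ s, (cdf ν (b - s) - cdf γ (b - s)) * fejer s)).abs
  rw [sub_zero] at h2
  refine le_of_tendsto h2 ?_
  filter_upwards [eventually_le_atBot b] with a ha
  exact abs_integral_cdf_sub_le ν γ hG h ha

end Smoothing

/-! ### Esseen's smoothing inequality -/

/-- If a bounded function decreases at rate at most `m`, its positive values are controlled by its
averages against the Fejér kernel. -/
lemma le_of_integral_mul_fejer_le {Δ : ℝ → ℝ} {η m κ d x₀ : ℝ} (hm : 0 < m)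
    (hΔ : Measurable Δ) (hη : ∀ x, |Δ x| ≤ η) (hdec : ∀ x y, x ≤ y → Δ x - m * (y - x) ≤ Δ y)
    (hd : 0 < d) (hd2 : η ≤ 2 * d) (hx₀ : d ≤ Δ x₀)
    (hκ : ∀ x, ∫ s, Δ (x - s) * fejer s ≤ κ) :
    d ≤ 2 / (∫ s, fejer s) * (κ + 80 * m) := by
  set I := ∫ s, fejer s with hI
  have hIpos : 0 < I := integral_fejer_pos
  -- On `[x₀, x₀ + 2 h]`, the window of radius `h` about `x₀ + h`, the function loses at most `2 h m
  -- = d / 2`, so it stays above `d / 2`.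
  set h := d / (4 * m) with hh
  have hhpos : 0 < h := by positivity
  have hint : Integrable (fun s => Δ (x₀ + h - s) * fejer s) := by
    refine integrable_fejer.bdd_mul (c := η) ?_ (ae_of_all _ fun s => hη _)
    exact (hΔ.comp (measurable_const.sub measurable_id)).aestronglyMeasurable
  have htail := setIntegral_fejer_tail_le hhpos
  set τ := ∫ s in (Set.Icc (-h) h)ᶜ, fejer s with hτ
  have hτ0 : 0 ≤ τ := integral_nonneg fejer_nonneg
  have hmass : ∫ s in Set.Icc (-h) h, fejer s = I - τ := by
    rw [hI, ← integral_add_compl (measurableSet_Icc (a := -h) (b := h)) integrable_fejer]; ring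
  have h1 : d / 2 * (I - τ) ≤ ∫ s in Set.Icc (-h) h, Δ (x₀ + h - s) * fejer s := by
    rw [← hmass, ← integral_const_mul]
    refine setIntegral_mono_on (integrable_fejer.integrableOn.const_mul _) hint.integrableOn
      measurableSet_Icc fun s hs => mul_le_mul_of_nonneg_right ?_ (fejer_nonneg s)
    have h3 := hdec x₀ (x₀ + h - s) (by linarith [hs.2])
    have h4 : m * (x₀ + h - s - x₀) ≤ d / 2 := by
      calc m * (x₀ + h - s - x₀) ≤ m * (2 * h) :=
            mul_le_mul_of_nonneg_left (by linarith [hs.1]) hm.le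
        _ = d / 2 := by rw [hh]; field_simp; ring
    linarith
  have h2 : -η * τ ≤ ∫ s in (Set.Icc (-h) h)ᶜ, Δ (x₀ + h - s) * fejer s := by
    rw [hτ, ← integral_const_mul]
    refine setIntegral_mono_on (integrable_fejer.integrableOn.const_mul _) hint.integrableOn
      measurableSet_Icc.compl fun s _ => mul_le_mul_of_nonneg_right ?_ (fejer_nonneg s)
    exact (abs_le.1 (hη _)).1
  have h3 := hκ (x₀ + h)
  rw [← integral_add_compl (measurableSet_Icc (a := -h) (b := h)) hint] at h3
  have h4 : d * τ ≤ 32 * m := by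
    calc d * τ ≤ d * (8 / h) := mul_le_mul_of_nonneg_left htail hd.le
      _ = 32 * m := by rw [hh]; field_simp; ring
  have h5 : η * τ ≤ 2 * d * τ := mul_le_mul_of_nonneg_right hd2 hτ0
  -- Window and tail give `κ ≥ (d / 2) (I - τ) - 2 d τ = d I / 2 - (5 / 2) d τ`, and `d τ ≤ 32 m`;
  -- hence the constant `80`.
  have h6 : d / 2 * I ≤ κ + 80 * m := by nlinarith
  rw [div_mul_eq_mul_div, le_div_iff₀ hIpos]
  linarith

/-- **Esseen's smoothing inequality**, at unit scale. -/
theorem abs_cdf_sub_cdf_le (ν γ : Measure ℝ) [IsProbabilityMeasure ν] [IsProbabilityMeasure γ]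
    {G : ℝ → ℝ} (hG : Continuous G) {m : ℝ} (hm : 0 < m)
    (hlip : ∀ x y, x ≤ y → cdf γ y - cdf γ x ≤ m * (y - x))
    (h : ∀ t ∈ Set.Icc (-1 : ℝ) 1, ‖charFun ν (-t) - charFun γ (-t)‖ ≤ |t| * G t) (x : ℝ) :
    |cdf ν x - cdf γ x| ≤ 4 / (∫ s, fejer s) * (2 * (∫ t in (-1 : ℝ)..1, G t) + 80 * m) := by
  set Δ : ℝ → ℝ := fun x => cdf ν x - cdf γ x with hΔ
  set κ := 2 * ∫ t in (-1 : ℝ)..1, G t with hκ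
  have hbdd : ∀ x, |Δ x| ≤ 1 := fun x => abs_le.2
    ⟨by simp only [hΔ]; linarith [cdf_nonneg ν x, cdf_le_one γ x],
      by simp only [hΔ]; linarith [cdf_nonneg γ x, cdf_le_one ν x]⟩
  have hBdd : BddAbove (Set.range fun x => |Δ x|) := ⟨1, by rintro _ ⟨x, rfl⟩; exact hbdd x⟩
  set η := ⨆ x, |Δ x| with hη
  have hle : ∀ x, |Δ x| ≤ η := fun x => le_ciSup hBdd x
  have hmeas : Measurable Δ := (monotone_cdf ν).measurable.sub (monotone_cdf γ).measurable
  have hsm : ∀ x, |∫ s, Δ (x - s) * fejer s| ≤ κ := abs_integral_cdf_le ν γ hG h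
  rcases (abs_nonneg _).trans (hle x) |>.eq_or_lt with h0 | hpos
  · have hκ0 : 0 ≤ κ := (abs_nonneg _).trans (hsm 0)
    refine (hle x).trans ?_
    rw [← h0]
    have := integral_fejer_pos
    positivity
  -- The supremum need not be attained; a point with more than half of it is enough for the previous
  -- lemma.
  obtain ⟨x₀, hx₀⟩ := exists_lt_of_lt_ciSup (show η / 2 < ⨆ x, |Δ x| by linarith)
  have key : |Δ x₀| ≤ 2 / (∫ s, fejer s) * (κ + 80 * m) := by
    have hd : 0 < |Δ x₀| := by linarith
    rcases le_total 0 (Δ x₀) with hs | hs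
    · rw [abs_of_nonneg hs] at hx₀ hd ⊢
      refine le_of_integral_mul_fejer_le hm hmeas hle ?_ hd (by linarith) le_rfl
        (fun x => (le_abs_self _).trans (hsm x))
      intro x y hxy
      simp only [hΔ]
      linarith [hlip x y hxy, monotone_cdf ν hxy]
    · rw [abs_of_nonpos hs] at hx₀ hd ⊢
      -- A negative extremum is reflected to a positive one; `x ↦ -Δ (-x)` again decreases at rate
      -- at most `m`.
      refine le_of_integral_mul_fejer_le (Δ := fun x => -Δ (-x)) (x₀ := -x₀) hm
        (hmeas.comp measurable_neg).neg (fun x => by simpa using hle (-x)) ?_ hd (by linarith)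
        (by simp) ?_
      · intro x y hxy
        have hxy' : -y ≤ -x := by linarith
        simp only [hΔ]
        linarith [hlip _ _ hxy', monotone_cdf ν hxy']
      · intro x
        have h1 : ∫ s, -Δ (-(x - s)) * fejer s = -∫ s, Δ (-x - s) * fejer s := by
          rw [← integral_neg, ← integral_neg_eq_self]
          congr 1 with s
          rw [fejer_neg, neg_mul]
          congr 3; ring
        rw [h1]
        exact (neg_le_abs _).trans (hsm (-x))
  calc |Δ x| ≤ η := hle x
    _ ≤ 2 * |Δ x₀| := by linarith
    _ ≤ 2 * (2 / (∫ s, fejer s) * (κ + 80 * m)) := by linarith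
    _ = _ := by ring

/-! ### Normalized cumulant generating functions and their saddle points -/

/-- Analytic functions on the disc of radius `R` that behave like the cumulant generating function
of a centred variable of variance one, with `A`-Lipschitz second derivative. -/
structure IsNormalizedCGF (φ : ℂ → ℂ) (R A : ℝ) : Prop where
  differentiableOn : DifferentiableOn ℂ φ (Metric.ball 0 R)
  map_zero : φ 0 = 0
  deriv_zero : deriv φ 0 = 0
  deriv_deriv_zero : deriv (deriv φ) 0 = 1
  lipschitz : ∀ z ∈ Metric.ball (0 : ℂ) R, ∀ w ∈ Metric.ball (0 : ℂ) R,
    ‖deriv (deriv φ) z - deriv (deriv φ) w‖ ≤ A * ‖z - w‖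
  map_conj : ∀ z, φ (starRingEnd ℂ z) = starRingEnd ℂ (φ z)

namespace IsNormalizedCGF

variable {φ : ℂ → ℂ} {R A r : ℝ} (h : IsNormalizedCGF φ R A)
include h

lemma hasDerivAt {z : ℂ} (hz : z ∈ Metric.ball (0 : ℂ) R) : HasDerivAt φ (deriv φ z) z :=
  (h.differentiableOn.differentiableAt (Metric.isOpen_ball.mem_nhds hz)).hasDerivAt

lemma hasDerivAt_deriv {z : ℂ} (hz : z ∈ Metric.ball (0 : ℂ) R) :
    HasDerivAt (deriv φ) (deriv (deriv φ) z) z :=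
  ((h.differentiableOn.deriv Metric.isOpen_ball).differentiableAt
    (Metric.isOpen_ball.mem_nhds hz)).hasDerivAt

lemma deriv_conj (z : ℂ) : deriv φ (starRingEnd ℂ z) = starRingEnd ℂ (deriv φ z) := by
  have h1 : (starRingEnd ℂ) ∘ φ ∘ (starRingEnd ℂ) = φ := by
    ext z; simp [h.map_conj]
  have h2 := congrFun (deriv_conj_conj (f := φ)) z
  rw [h1] at h2
  simp [h2]

lemma deriv_deriv_conj (z : ℂ) :
    deriv (deriv φ) (starRingEnd ℂ z) = starRingEnd ℂ (deriv (deriv φ) z) := by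
  have h1 : (starRingEnd ℂ) ∘ deriv φ ∘ (starRingEnd ℂ) = deriv φ := by
    ext z; simp [h.deriv_conj]
  have h2 := congrFun (deriv_conj_conj (f := deriv φ)) z
  rw [h1] at h2
  simp [h2]

lemma norm_deriv_deriv_sub_one_le (hr : 0 < r) (hrR : r ≤ R) {z : ℂ}
    (hz : z ∈ Metric.ball (0 : ℂ) r) : ‖deriv (deriv φ) z - 1‖ ≤ A * ‖z‖ := by
  have := h.lipschitz z (Metric.ball_subset_ball hrR hz) 0 (Metric.mem_ball_self (hr.trans_le hrR))
  rwa [h.deriv_deriv_zero, sub_zero] at this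

lemma norm_deriv_deriv_sub_one_le_half (hA : 0 ≤ A) (hr : 0 < r) (hrR : r ≤ R) (hAr : A * r ≤ 1 / 2)
    {z : ℂ} (hz : z ∈ Metric.ball (0 : ℂ) r) : ‖deriv (deriv φ) z - 1‖ ≤ 1 / 2 := by
  refine (h.norm_deriv_deriv_sub_one_le hr hrR hz).trans (le_trans ?_ hAr)
  rw [mem_ball_zero_iff] at hz
  gcongr

/-- Since `φ'' - 1` is at most `1 / 2` on the disc, `φ'` is a perturbation of the identity with
Lipschitz constant `1 / 2`. Injectivity and the size of the image of `φ'` both come from this. -/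
lemma norm_deriv_sub_sub_le (hA : 0 ≤ A) (hr : 0 < r) (hrR : r ≤ R) (hAr : A * r ≤ 1 / 2)
    {z w : ℂ} (hz : z ∈ Metric.ball (0 : ℂ) r) (hw : w ∈ Metric.ball (0 : ℂ) r) :
    ‖deriv φ z - deriv φ w - (z - w)‖ ≤ 1 / 2 * ‖z - w‖ := by
  have key := Convex.norm_image_sub_le_of_norm_hasDerivWithin_le (𝕜 := ℂ)
    (f := fun z => deriv φ z - z) (f' := fun z => deriv (deriv φ) z - 1) (C := 1 / 2)
    (s := Metric.ball (0 : ℂ) r) (x := w) (y := z)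
    (fun x hx => ((h.hasDerivAt_deriv (Metric.ball_subset_ball hrR hx)).sub
      (hasDerivAt_id x)).hasDerivWithinAt)
    (fun x hx => h.norm_deriv_deriv_sub_one_le_half hA hr hrR hAr hx) (convex_ball _ _) hw hz
  rwa [sub_sub_sub_comm] at key

lemma norm_sub_le (hA : 0 ≤ A) (hr : 0 < r) (hrR : r ≤ R) (hAr : A * r ≤ 1 / 2)
    {z w : ℂ} (hz : z ∈ Metric.ball (0 : ℂ) r) (hw : w ∈ Metric.ball (0 : ℂ) r) :
    ‖z - w‖ ≤ 2 * ‖deriv φ z - deriv φ w‖ := by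
  have h1 := h.norm_deriv_sub_sub_le hA hr hrR hAr hz hw
  have h2 := norm_sub_norm_le (z - w) (deriv φ z - deriv φ w)
  rw [norm_sub_rev (z - w) (deriv φ z - deriv φ w)] at h2
  linarith

lemma norm_deriv_sub_self_le (hA : 0 ≤ A) (hr : 0 < r) (hrR : r ≤ R) (hAr : A * r ≤ 1 / 2)
    {z : ℂ} (hz : z ∈ Metric.ball (0 : ℂ) r) : ‖deriv φ z - z‖ ≤ 1 / 2 * ‖z‖ := by
  simpa [h.deriv_zero] using h.norm_deriv_sub_sub_le hA hr hrR hAr hz (Metric.mem_ball_self hr)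

lemma norm_map_le (hA : 0 ≤ A) (hr : 0 < r) (hrR : r ≤ R) (hAr : A * r ≤ 1 / 2)
    {z : ℂ} (hz : z ∈ Metric.ball (0 : ℂ) r) : ‖φ z‖ ≤ 3 / 2 * r * ‖z‖ := by
  have key := Convex.norm_image_sub_le_of_norm_hasDerivWithin_le (𝕜 := ℂ)
    (f := φ) (f' := deriv φ) (C := 3 / 2 * r) (s := Metric.ball (0 : ℂ) r) (x := 0) (y := z)
    (fun x hx => (h.hasDerivAt (Metric.ball_subset_ball hrR hx)).hasDerivWithinAt)
    (fun x hx => by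
      have h1 := h.norm_deriv_sub_self_le hA hr hrR hAr hx
      have h2 := norm_sub_norm_le (deriv φ x) x
      have h3 := mem_ball_zero_iff.1 hx
      linarith) (convex_ball _ _) (Metric.mem_ball_self hr) hz
  simpa [h.map_zero] using key

/-- A quantitative inverse function theorem for `φ'`: the radius `r / 4` on which the saddle point
exists depends on `R` and `A` only. -/
lemma exists_saddle (hA : 0 ≤ A) (hr : 0 < r) (hrR : r ≤ R) (hAr : A * r ≤ 1 / 2) :
    ∃ t : ℂ → ℂ, ∀ y ∈ Metric.ball (0 : ℂ) (r / 4), t y ∈ Metric.ball (0 : ℂ) r ∧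
      deriv φ (t y) = y ∧ ‖t y‖ ≤ 2 * ‖y‖ ∧ HasDerivAt t (deriv (deriv φ) (t y))⁻¹ y := by
  have happ : ApproximatesLinearOn (deriv φ)
      ((ContinuousLinearEquiv.refl ℂ ℂ : ℂ ≃L[ℂ] ℂ) : ℂ →L[ℂ] ℂ) (Metric.ball 0 r) (1 / 2) := by
    intro x hx y hy
    simpa using h.norm_deriv_sub_sub_le hA hr hrR hAr hx hy
  let inv : ((ContinuousLinearEquiv.refl ℂ ℂ : ℂ ≃L[ℂ] ℂ) : ℂ →L[ℂ] ℂ).NonlinearRightInverse :=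
    { toFun := id, nnnorm := 1, bound' := by simp, right_inv' := by simp }
  have hsurj := happ.surjOn_closedBall_of_nonlinearRightInverse inv (ε := r / 2) (b := 0)
    (by positivity) (Metric.closedBall_subset_ball (by linarith))
  have hrad : (((inv.nnnorm : ℝ))⁻¹ - ((1 / 2 : NNReal) : ℝ)) * (r / 2) = r / 4 := by
    simp [inv]; ring
  rw [hrad, h.deriv_zero] at hsurj
  have hex : ∀ y : ℂ, ∃ z : ℂ, y ∈ Metric.ball (0 : ℂ) (r / 4) →
      z ∈ Metric.ball (0 : ℂ) r ∧ deriv φ z = y := by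
    intro y
    by_cases hy : y ∈ Metric.ball (0 : ℂ) (r / 4)
    · obtain ⟨z, hz, hzy⟩ := hsurj (Metric.ball_subset_closedBall hy)
      exact ⟨z, fun _ => ⟨Metric.closedBall_subset_ball (by linarith) hz, hzy⟩⟩
    · exact ⟨0, fun hy' => absurd hy' hy⟩
  choose t ht using hex
  refine ⟨t, fun y hy => ⟨(ht y hy).1, (ht y hy).2, ?_, ?_⟩⟩
  · have := h.norm_sub_le hA hr hrR hAr (ht y hy).1 (Metric.mem_ball_self hr)
    simpa [h.deriv_zero, (ht y hy).2] using this
  · have hnhds : Metric.ball (0 : ℂ) (r / 4) ∈ 𝓝 y := Metric.isOpen_ball.mem_nhds hy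
    refine HasDerivAt.of_local_left_inverse (f := deriv φ) ?_
      (h.hasDerivAt_deriv (Metric.ball_subset_ball hrR (ht y hy).1)) ?_ ?_
    -- The inverse was chosen pointwise; the expansion bound `norm_sub_le` makes it `2`-Lipschitz,
    -- hence continuous.
    · rw [ContinuousAt, tendsto_iff_norm_sub_tendsto_zero]
      refine squeeze_zero' (g := fun y' => 2 * ‖y' - y‖) (Eventually.of_forall fun _ => norm_nonneg _)
        ?_ ?_
      · filter_upwards [hnhds] with y' hy'
        have := h.norm_sub_le hA hr hrR hAr (ht y' hy').1 (ht y hy).1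
        rwa [(ht y' hy').2, (ht y hy).2] at this
      · have : Continuous fun y' : ℂ => 2 * ‖y' - y‖ := by fun_prop
        simpa using this.tendsto y
    · intro h0
      have := h.norm_deriv_deriv_sub_one_le_half hA hr hrR hAr (ht y hy).1
      rw [h0] at this
      norm_num at this
    · filter_upwards [hnhds] with y' hy' using (ht y' hy').2

end IsNormalizedCGF

/-! ### The Cramér series -/

/-- `t` is the germ at `0` of a local inverse of `φ'`. -/
def IsSaddleGerm (φ t : ℂ → ℂ) : Prop :=
  AnalyticAt ℂ t 0 ∧ t 0 = 0 ∧ ∀ᶠ y in 𝓝 0, deriv φ (t y) = y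

open Classical in
/-- The local inverse of `φ'` at `0`. -/
def saddleGerm (φ : ℂ → ℂ) : ℂ → ℂ :=
  if h : ∃ t, IsSaddleGerm φ t then h.choose else 0

/-- `y² / 2` minus the Legendre transform of `φ`, when `t` is the local inverse of `φ'`. -/
def legendreDefect (φ t : ℂ → ℂ) (y : ℂ) : ℂ := y ^ 2 / 2 - (t y * y - φ (t y))

/-- The coefficients `β_k` of the Cramér series of `φ`:
`y² / 2 - φ*(y) = y³ ∑ β_k y^k`, where `φ*` is the Legendre transform of `φ`. -/
def cramerCoeff (φ : ℂ → ℂ) (k : ℕ) : ℝ :=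
  (iteratedDeriv (k + 3) (legendreDefect φ (saddleGerm φ)) 0).re / (k + 3).factorial

/-- As `φ''(0) = 1`, `φ'` is injective near `0`, so its local inverse is unique as a germ. This
makes the coefficients a function of `φ` alone, independent of the choice and of the radii. -/
lemma IsNormalizedCGF.saddleGerm_eventuallyEq {φ t : ℂ → ℂ} {R A : ℝ} (h : IsNormalizedCGF φ R A)
    (hR : 0 < R) (ht : IsSaddleGerm φ t) : saddleGerm φ =ᶠ[𝓝 0] t := by
  have hex : ∃ t, IsSaddleGerm φ t := ⟨t, ht⟩
  have hs : IsSaddleGerm φ (saddleGerm φ) := by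
    rw [saddleGerm, dif_pos hex]; exact hex.choose_spec
  have h0 : (0 : ℂ) ∈ Metric.ball (0 : ℂ) R := Metric.mem_ball_self hR
  have hstrict : HasStrictDerivAt (deriv φ) 1 0 := by
    have h2 : AnalyticAt ℂ (deriv φ) 0 :=
      ((h.differentiableOn.analyticAt (Metric.isOpen_ball.mem_nhds h0))).deriv
    have h3 := h2.hasStrictDerivAt
    rwa [h.deriv_deriv_zero] at h3
  have hinj := hstrict.eventually_left_inverse one_ne_zero
  have h1 : Tendsto (saddleGerm φ) (𝓝 0) (𝓝 0) := by
    simpa [ContinuousAt, hs.2.1] using hs.1.continuousAt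
  have h2 : Tendsto t (𝓝 0) (𝓝 0) := by
    simpa [ContinuousAt, ht.2.1] using ht.1.continuousAt
  filter_upwards [h1.eventually hinj, h2.eventually hinj, hs.2.2, ht.2.2] with y h3 h4 h5 h6
  rw [← h3, ← h4, h5, h6]

lemma IsNormalizedCGF.exists_saddleGerm {φ : ℂ → ℂ} {R A r : ℝ} (h : IsNormalizedCGF φ R A)
    (hA : 0 ≤ A) (hr : 0 < r) (hrR : r ≤ R) (hAr : A * r ≤ 1 / 2) :
    ∃ t : ℂ → ℂ, (∀ y ∈ Metric.ball (0 : ℂ) (r / 4), t y ∈ Metric.ball (0 : ℂ) r ∧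
      deriv φ (t y) = y ∧ ‖t y‖ ≤ 2 * ‖y‖ ∧ HasDerivAt t (deriv (deriv φ) (t y))⁻¹ y) ∧
      ∀ k, cramerCoeff φ k = (iteratedDeriv (k + 3) (legendreDefect φ t) 0).re / (k + 3).factorial := by
  obtain ⟨t, ht⟩ := h.exists_saddle hA hr hrR hAr
  refine ⟨t, ht, fun k => ?_⟩
  have hnhds : Metric.ball (0 : ℂ) (r / 4) ∈ 𝓝 0 := Metric.ball_mem_nhds _ (by positivity)
  have hgerm : IsSaddleGerm φ t := by
    refine ⟨?_, ?_, ?_⟩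
    · have : DifferentiableOn ℂ t (Metric.ball 0 (r / 4)) :=
        fun y hy => (ht y hy).2.2.2.differentiableAt.differentiableWithinAt
      exact this.analyticAt hnhds
    · have := (ht 0 (mem_of_mem_nhds hnhds)).2.2.1
      simpa using this
    · filter_upwards [hnhds] with y hy using (ht y hy).2.1
  have heq : legendreDefect φ (saddleGerm φ) =ᶠ[𝓝 0] legendreDefect φ t := by
    filter_upwards [h.saddleGerm_eventuallyEq (hr.trans_le hrR) hgerm] with y hy
    simp only [legendreDefect, hy]
  rw [cramerCoeff, heq.iteratedDeriv_eq]

/-- The Cramér series converges in a disc that depends on `R` and `A` only. -/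
theorem exists_cramerSeries {R A : ℝ} (hR : 0 < R) (hA : 0 < A) :
    ∃ ρ > 0, ∃ D : ℝ, ∀ φ : ℂ → ℂ, IsNormalizedCGF φ R A →
      (∀ z : ℂ, ‖z‖ < ρ → Summable (fun k => (cramerCoeff φ k : ℂ) * z ^ k) ∧
        ‖∑' k, (cramerCoeff φ k : ℂ) * z ^ k‖ ≤ D) ∧
      ∀ y : ℝ, 0 ≤ y → y < ρ → ∃ s : ℝ, 0 ≤ s ∧ s ≤ 2 * y ∧ y ≤ 2 * s ∧ deriv φ s = y ∧
        s * y - (φ s).re = y ^ 2 / 2 - y ^ 3 * ∑' k, cramerCoeff φ k * y ^ k := by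
  set r := min R (1 / (2 * A)) with hrdef
  have hr : 0 < r := lt_min hR (by positivity)
  have hrR : r ≤ R := min_le_left _ _
  have hAr : A * r ≤ 1 / 2 := by
    calc A * r ≤ A * (1 / (2 * A)) := by gcongr; exact min_le_right _ _
      _ = 1 / 2 := by field_simp
  set ρ₁ := r / 8 with hρ₁
  have hρ₁pos : 0 < ρ₁ := by positivity
  set C := 4 * r ^ 2 with hC
  refine ⟨ρ₁ / 2, by positivity, ∑' k : ℕ, C / ρ₁ ^ 3 * (1 / 2) ^ k, fun φ h => ?_⟩
  obtain ⟨t, ht, hcoef⟩ := h.exists_saddleGerm hA.le hr hrR hAr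
  set E := legendreDefect φ t with hE
  -- Envelope identity: the two terms with `t'` cancel because `φ'(t y) = y`.
  have hEd : ∀ y ∈ Metric.ball (0 : ℂ) (r / 4), HasDerivAt E (y - t y) y := by
    intro y hy
    obtain ⟨h1, h2, -, h4⟩ := ht y hy
    have h5 := (h.hasDerivAt (Metric.ball_subset_ball hrR h1)).comp y h4
    rw [h2] at h5
    have h6 := (((hasDerivAt_id y).pow 2).div_const 2).sub ((h4.mul (hasDerivAt_id y)).sub h5)
    convert! h6 using 1
    simp only [id]; ring
  have hEbound : ∀ y ∈ Metric.ball (0 : ℂ) (r / 4), ‖E y‖ ≤ C := by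
    intro y hy
    obtain ⟨h1, h2, h3, -⟩ := ht y hy
    have h5 := h.norm_map_le hA.le hr hrR hAr h1
    rw [mem_ball_zero_iff] at h1 hy
    have h6 : ‖E y‖ ≤ ‖y‖ ^ 2 / 2 + (‖t y‖ * ‖y‖ + ‖φ (t y)‖) := by
      rw [hE, legendreDefect]
      refine (norm_sub_le _ _).trans (add_le_add (by simp) ((norm_sub_le _ _).trans (by simp)))
    have h7 : ‖t y‖ * ‖y‖ ≤ r * (r / 4) := mul_le_mul h1.le hy.le (norm_nonneg _) hr.le
    have h8 : ‖y‖ ^ 2 ≤ (r / 4) ^ 2 := pow_le_pow_left₀ (norm_nonneg _) hy.le 2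
    nlinarith
  have hEdiff : DifferentiableOn ℂ E (Metric.ball 0 (r / 4)) :=
    fun y hy => (hEd y hy).differentiableAt.differentiableWithinAt
  have hnhds : Metric.ball (0 : ℂ) (r / 4) ∈ 𝓝 0 := Metric.ball_mem_nhds _ (by positivity)
  have ht0 : t 0 = 0 := by simpa using (ht 0 (mem_of_mem_nhds hnhds)).2.2.1
  have hE0 : E 0 = 0 := by simp [hE, legendreDefect, ht0, h.map_zero]
  have hderiv : deriv E =ᶠ[𝓝 0] fun y => y - t y := by
    filter_upwards [hnhds] with y hy using (hEd y hy).deriv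
  have hE1 : iteratedDeriv 1 E 0 = 0 := by
    rw [iteratedDeriv_one, hderiv.self_of_nhds]; simp [ht0]
  have hE2 : iteratedDeriv 2 E 0 = 0 := by
    rw [iteratedDeriv_succ, iteratedDeriv_one, hderiv.deriv_eq]
    have h1 := (ht 0 (mem_of_mem_nhds hnhds)).2.2.2
    rw [ht0, h.deriv_deriv_zero] at h1
    have h2 : HasDerivAt (fun y => y - t y) (1 - 1⁻¹) 0 := (hasDerivAt_id (0 : ℂ)).sub h1
    simpa using h2.deriv
  -- Cauchy's estimate on radius `r / 8`. Halving the radius once more makes the series geometric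
  -- with ratio `1 / 2`, uniformly in `φ`.
  have hcauchy : ∀ n, ‖iteratedDeriv n E 0‖ ≤ n.factorial * C / ρ₁ ^ n := by
    intro n
    have hsub : Metric.closedBall (0 : ℂ) ρ₁ ⊆ Metric.ball 0 (r / 4) :=
      Metric.closedBall_subset_ball (by rw [hρ₁]; linarith)
    refine Complex.norm_iteratedDeriv_le_of_forall_mem_sphere_norm_le n hρ₁pos ?_ ?_
    · refine DifferentiableOn.diffContOnCl ?_
      exact hEdiff.mono ((closure_mono Metric.ball_subset_closedBall).trans
        (Metric.isClosed_closedBall.closure_subset.trans hsub))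
    · exact fun z hz => hEbound z (hsub (Metric.sphere_subset_closedBall hz))
  have hβ : ∀ k, |cramerCoeff φ k| ≤ C / ρ₁ ^ (k + 3) := by
    intro k
    rw [hcoef, abs_div, Nat.abs_cast, div_le_iff₀ (by positivity)]
    refine (Complex.abs_re_le_norm _).trans ((hcauchy _).trans (le_of_eq ?_))
    ring
  have hterm : ∀ z : ℂ, ‖z‖ < ρ₁ / 2 → ∀ k,
      ‖(cramerCoeff φ k : ℂ) * z ^ k‖ ≤ C / ρ₁ ^ 3 * (1 / 2) ^ k := by
    intro z hz k
    rw [norm_mul, norm_pow, Complex.norm_real, Real.norm_eq_abs]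
    calc |cramerCoeff φ k| * ‖z‖ ^ k ≤ C / ρ₁ ^ (k + 3) * (ρ₁ / 2) ^ k := by
          gcongr
          exact hβ k
      _ = C / ρ₁ ^ 3 * (1 / 2) ^ k := by
          rw [pow_add, div_eq_mul_one_div ρ₁ 2, mul_pow]; field_simp
  have hgeom : Summable fun k : ℕ => C / ρ₁ ^ 3 * (1 / 2 : ℝ) ^ k :=
    (summable_geometric_of_lt_one (by norm_num) (by norm_num)).mul_left _
  refine ⟨fun z hz => ⟨Summable.of_norm_bounded hgeom (hterm z hz),
    tsum_of_norm_bounded hgeom.hasSum (hterm z hz)⟩, fun y hy0 hyρ => ?_⟩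
  have hyball : (y : ℂ) ∈ Metric.ball (0 : ℂ) (r / 4) := by
    rw [mem_ball_zero_iff, Complex.norm_real, Real.norm_of_nonneg hy0]
    rw [hρ₁] at hyρ; linarith
  obtain ⟨h1, h2, h3, -⟩ := ht y hyball
  -- For real `y` the conjugate of the saddle point is again a saddle point, so uniqueness makes it
  -- real.
  have hreal : starRingEnd ℂ (t y) = t y := by
    have hc : starRingEnd ℂ (t y) ∈ Metric.ball (0 : ℂ) r := by
      rw [mem_ball_zero_iff] at h1 ⊢; simpa using h1
    have := h.norm_sub_le hA.le hr hrR hAr hc h1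
    rw [h.deriv_conj, h2, Complex.conj_ofReal, sub_self, norm_zero, mul_zero] at this
    exact sub_eq_zero.1 (norm_le_zero_iff.1 this)
  obtain ⟨s, hs⟩ := Complex.conj_eq_iff_real.1 hreal
  have h4 := h.norm_deriv_sub_self_le hA.le hr hrR hAr h1
  rw [h2, hs, ← Complex.ofReal_sub, Complex.norm_real, Complex.norm_real, Real.norm_eq_abs,
    Real.norm_eq_abs] at h4
  have hs0 : 0 ≤ s := by
    by_contra hneg
    push Not at hneg
    rw [abs_of_neg hneg] at h4
    linarith [(abs_le.1 h4).2]
  rw [abs_of_nonneg hs0] at h4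
  refine ⟨s, hs0, by linarith [(abs_le.1 h4).1], by linarith [(abs_le.1 h4).2], by rw [← hs, h2], ?_⟩
  have hsum := Complex.hasSum_taylorSeries_on_ball hEdiff hyball
  have hsum2 := Complex.hasSum_re hsum
  have hfun : ∀ n : ℕ, (((n.factorial : ℂ))⁻¹ • ((y : ℂ) - 0) ^ n • iteratedDeriv n E 0).re
      = y ^ n * ((iteratedDeriv n E 0).re / n.factorial) := by
    intro n
    rw [sub_zero, smul_eq_mul, smul_eq_mul, ← mul_assoc, ← Complex.ofReal_natCast,
      ← Complex.ofReal_inv, ← Complex.ofReal_pow, ← Complex.ofReal_mul, Complex.re_ofReal_mul]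
    field_simp
  simp_rw [hfun] at hsum2
  -- The Taylor coefficients of orders `0`, `1`, `2` vanish, which leaves the factor `y ^ 3`.
  rw [← hasSum_nat_add_iff' 3] at hsum2
  have hz : ∑ i ∈ Finset.range 3, y ^ i * ((iteratedDeriv i E 0).re / (i.factorial : ℝ)) = 0 := by
    simp [Finset.sum_range_succ, hE1, hE2, hE0]
  rw [hz, sub_zero] at hsum2
  have hEy : (E y).re = y ^ 2 / 2 - (s * y - (φ s).re) := by
    rw [hE, legendreDefect, hs, ← Complex.ofReal_mul, ← Complex.ofReal_pow, Complex.sub_re,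
      Complex.sub_re, Complex.ofReal_re,
      show ((y ^ 2 : ℝ) : ℂ) / 2 = ((y ^ 2 / 2 : ℝ) : ℂ) by push_cast; ring, Complex.ofReal_re]
  have htsum : y ^ 3 * ∑' k, cramerCoeff φ k * y ^ k = (E y).re := by
    rw [← hsum2.tsum_eq, ← tsum_mul_left]
    refine tsum_congr fun k => ?_
    rw [hcoef]; ring
  rw [htsum, hEy]; ring

/-! ### The Mills ratio -/

/-- The Mills ratio `exp (θ² / 2) (1 - Φ θ)`, as a Laplace transform. -/
def mills (θ : ℝ) : ℝ := ∫ z in Set.Ioi 0, Real.exp (-(θ * z)) ∂gaussianReal 0 1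

lemma integrable_exp_neg_mul_gaussianReal (θ : ℝ) (v : NNReal) :
    Integrable (fun z => Real.exp (-(θ * z))) (gaussianReal 0 v) := by
  simpa using integrable_exp_mul_gaussianReal (μ := 0) (v := v) (-θ)

lemma mills_pos (θ : ℝ) : 0 < mills θ := by
  rw [mills, setIntegral_pos_iff_support_of_nonneg_ae (ae_of_all _ fun z => (Real.exp_pos _).le)
    (integrable_exp_neg_mul_gaussianReal θ 1).integrableOn]
  have : Function.support (fun z : ℝ => Real.exp (-(θ * z))) = Set.univ :=
    Set.eq_univ_of_forall fun z => (Real.exp_pos _).ne'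
  rw [this, Set.univ_inter, gaussianReal_apply _ one_ne_zero]
  rw [setLIntegral_pos_iff (measurable_gaussianPDF _ _)]
  rw [support_gaussianPDF one_ne_zero]
  simp

lemma mills_anti {a b : ℝ} (hab : a ≤ b) : mills b ≤ mills a := by
  refine setIntegral_mono_on (integrable_exp_neg_mul_gaussianReal b 1).integrableOn
    (integrable_exp_neg_mul_gaussianReal a 1).integrableOn measurableSet_Ioi fun z hz => ?_
  have hz' : (0 : ℝ) < z := hz
  gcongr

lemma mills_eq_integral (θ : ℝ) :
    mills θ = ∫ z in Set.Ioi 0, gaussianPDFReal 0 1 z * Real.exp (-(θ * z)) := by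
  rw [mills, ← integral_indicator measurableSet_Ioi,
    integral_gaussianReal_eq_integral_smul one_ne_zero, ← integral_indicator measurableSet_Ioi]
  congr 1 with z
  simp [Set.indicator]

lemma integrable_gaussianPDFReal_mul_exp (θ : ℝ) :
    Integrable (fun z => gaussianPDFReal 0 1 z * Real.exp (-(θ * z))) := by
  have h := integrable_exp_neg_mul_gaussianReal θ 1
  rw [gaussianReal_of_var_ne_zero _ one_ne_zero] at h
  rw [integrable_withDensity_iff_integrable_smul' (measurable_gaussianPDF _ _)
    (ae_of_all _ fun _ => gaussianPDF_lt_top)] at h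
  simpa [toReal_gaussianPDF] using h

/-- In other words `θ * mills θ` is increasing: substitute `z ↦ (b / a) z` and use that the Gaussian
density decreases on the half-line. -/
lemma mills_le_div_mul {a b : ℝ} (ha : 0 < a) (hab : a ≤ b) : mills a ≤ b / a * mills b := by
  have hb : 0 < b := ha.trans_le hab
  have hc : 0 < b / a := by positivity
  have h1 := integral_comp_mul_left_Ioi
    (fun z => gaussianPDFReal 0 1 z * Real.exp (-(a * z))) 0 hc
  rw [mul_zero, ← mills_eq_integral, smul_eq_mul] at h1
  have h2 : mills a = b / a *
      ∫ z in Set.Ioi 0, gaussianPDFReal 0 1 (b / a * z) * Real.exp (-(a * (b / a * z))) := by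
    rw [h1]; field_simp
  rw [h2]
  refine mul_le_mul_of_nonneg_left ?_ hc.le
  rw [mills_eq_integral]
  refine setIntegral_mono_on ?_ (integrable_gaussianPDFReal_mul_exp b).integrableOn
    measurableSet_Ioi fun z hz => ?_
  · exact ((integrable_gaussianPDFReal_mul_exp a).comp_mul_left' hc.ne').integrableOn
  · have hz' : (0 : ℝ) < z := hz
    rw [show a * (b / a * z) = b * z by field_simp]
    refine mul_le_mul_of_nonneg_right ?_ (Real.exp_pos _).le
    simp only [gaussianPDFReal, sub_zero]
    have h3 : z ≤ b / a * z := le_mul_of_one_le_left hz'.le ((one_le_div ha).2 hab)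
    gcongr

lemma one_sub_stdNormalCDF (x : ℝ) :
    1 - stdNormalCDF x = Real.exp (-(x ^ 2 / 2)) * mills x := by
  have h1 : 1 - stdNormalCDF x = (gaussianReal 0 1).real (Set.Ioi x) := by
    rw [stdNormalCDF, cdf_eq_real, ← probReal_compl_eq_one_sub measurableSet_Iic, Set.compl_Iic]
  have h2 : (gaussianReal 0 1).real (Set.Ioi x) = ∫ z in Set.Ioi x, gaussianPDFReal 0 1 z := by
    rw [measureReal_def, gaussianReal_apply_eq_integral _ one_ne_zero,
      ENNReal.toReal_ofReal (integral_nonneg fun z => gaussianPDFReal_nonneg _ _ _)]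
  have h3 := (measurePreserving_add_right volume x).setIntegral_preimage_emb
    (measurableEmbedding_addRight x) (gaussianPDFReal 0 1) (Set.Ioi x)
  rw [show (fun z => z + x) ⁻¹' Set.Ioi x = Set.Ioi 0 by ext; simp] at h3
  rw [h1, h2, ← h3, mills_eq_integral, ← integral_const_mul]
  congr 1 with z
  simp only [gaussianPDFReal, sub_zero, NNReal.coe_one, mul_one]
  rw [← mul_assoc, mul_comm (Real.exp _), mul_assoc, mul_assoc, ← Real.exp_add, ← Real.exp_add]
  congr 2
  ring

lemma one_sub_stdNormalCDF_pos (x : ℝ) : 0 < 1 - stdNormalCDF x := by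
  rw [one_sub_stdNormalCDF]
  exact mul_pos (Real.exp_pos _) (mills_pos _)

/-- This lower bound is what converts an absolute error into a relative one. -/
lemma mills_one_div_le {x : ℝ} (hx : 0 ≤ x) : mills 1 / (1 + x) ≤ mills x := by
  rcases le_total x 1 with h | h
  · exact (div_le_self (mills_pos 1).le (by linarith)).trans (mills_anti h)
  · have h1 := mills_le_div_mul one_pos h
    rw [div_one] at h1
    rw [div_le_iff₀ (by linarith)]
    nlinarith [mills_pos x]

/-- Because `mills` decreases while `θ * mills θ` increases, `mills` varies by at most the ratio of
its arguments. -/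
lemma abs_mills_div_sub_one_le {θ x e : ℝ} (hx : 0 < x) (he : e ≤ 1 / 2)
    (h : |θ / x - 1| ≤ e) : |mills θ / mills x - 1| ≤ 2 * e := by
  have hmx := mills_pos x
  have hmθ := mills_pos θ
  have he0 : 0 ≤ e := (abs_nonneg _).trans h
  obtain ⟨h1, h2⟩ := abs_le.1 h
  have hl : x / 2 ≤ θ := by
    have : 1 / 2 ≤ θ / x := by linarith
    rw [le_div_iff₀ hx] at this; linarith
  have hθ : 0 < θ := by linarith
  have h3 : θ ≤ (1 + e) * x := by
    rw [← div_le_iff₀ hx]; linarith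
  have h4 : (1 - e) * x ≤ θ := by
    rw [← le_div_iff₀ hx]; linarith
  rw [div_sub_one hmx.ne', abs_div, abs_of_pos hmx, div_le_iff₀ hmx, abs_le]
  rcases le_total x θ with hc | hc
  · have h5 := mills_le_div_mul hx hc
    have h6 := mills_anti hc
    have h7 : θ / x * mills θ ≤ (1 + e) * mills θ :=
      mul_le_mul_of_nonneg_right ((div_le_iff₀ hx).2 h3) hmθ.le
    constructor <;> nlinarith
  · have h5 := mills_le_div_mul hθ hc
    have h6 := mills_anti hc
    have h7 : x / θ ≤ 1 + 2 * e := by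
      rw [div_le_iff₀ hθ]
      have : x ≤ (1 + 2 * e) * ((1 - e) * x) := by nlinarith [mul_nonneg he0 hx.le]
      exact this.trans (mul_le_mul_of_nonneg_left h4 (by linarith))
    have h8 : x / θ * mills x ≤ (1 + 2 * e) * mills x := mul_le_mul_of_nonneg_right h7 hmx.le
    constructor <;> nlinarith

/-! ### Laplace transforms and distribution functions -/

/-- By the layer-cake formula the integral averages the measures of level sets. Each is an interval
`(0, c]`, on which two distribution functions at distance `η` differ by at most `2 η`. -/
lemma abs_setIntegral_exp_sub_le (ν γ : Measure ℝ) [IsProbabilityMeasure ν]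
    [IsProbabilityMeasure γ] {η κ : ℝ} (hκ : 0 ≤ κ) (h : ∀ x, |cdf ν x - cdf γ x| ≤ η) :
    |(∫ w in Set.Ioi 0, Real.exp (-(κ * w)) ∂ν) - ∫ w in Set.Ioi 0, Real.exp (-(κ * w)) ∂γ|
      ≤ 2 * η := by
  set f : ℝ → ℝ := (Set.Ioi (0 : ℝ)).indicator fun w => Real.exp (-(κ * w)) with hf
  have hf0 : ∀ w, 0 ≤ f w := fun w => Set.indicator_nonneg (fun _ _ => (Real.exp_pos _).le) w
  have hf1 : ∀ w, f w ≤ 1 := by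
    intro w
    simp only [hf, Set.indicator]
    split_ifs with hw
    · have hw' : (0 : ℝ) < w := hw
      rw [Real.exp_le_one_iff]; nlinarith
    · exact zero_le_one
  have hfm : Measurable f := (by fun_prop : Measurable fun w => Real.exp (-(κ * w))).indicator
    measurableSet_Ioi
  have hlayer : ∀ (ρ : Measure ℝ) [IsProbabilityMeasure ρ],
      ∫ w in Set.Ioi 0, Real.exp (-(κ * w)) ∂ρ = ∫ t in Set.Ioc 0 1, ρ.real {a | t ≤ f a} := by
    intro ρ _
    rw [← integral_indicator measurableSet_Ioi]
    refine Integrable.integral_eq_integral_Ioc_meas_le ?_ (ae_of_all _ hf0) (ae_of_all _ hf1)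
    exact Integrable.of_bound hfm.aestronglyMeasurable 1
      (ae_of_all _ fun w => by rw [Real.norm_of_nonneg (hf0 w)]; exact hf1 w)
  have hint : ∀ (ρ : Measure ℝ) [IsProbabilityMeasure ρ],
      IntegrableOn (fun t => ρ.real {a | t ≤ f a}) (Set.Ioc 0 1) := by
    intro ρ _
    refine Measure.integrableOn_of_bounded (M := 1) (by simp) ?_ (ae_of_all _ fun t => ?_)
    · have : Antitone fun t => ρ.real {a | t ≤ f a} := fun t t' htt =>
        measureReal_mono (fun a (ha : t' ≤ f a) => htt.trans ha)
      exact this.measurable.aestronglyMeasurable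
    · rw [Real.norm_of_nonneg measureReal_nonneg]; exact measureReal_le_one
  rw [hlayer ν, hlayer γ, ← integral_sub (hint ν) (hint γ), ← Real.norm_eq_abs]
  have hbound : ∀ t ∈ Set.Ioc (0 : ℝ) 1,
      ‖ν.real {a | t ≤ f a} - γ.real {a | t ≤ f a}‖ ≤ 2 * η := by
    intro t ht
    have hmem : ∀ w, t ≤ f w ↔ 0 < w ∧ t ≤ Real.exp (-(κ * w)) := by
      intro w
      simp only [hf, Set.indicator, Set.mem_Ioi]
      split_ifs with hw
      · simp [hw]
      · simp [hw, ht.1]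
    rw [Real.norm_eq_abs]
    -- For `κ = 0` the level set is the whole half-line `(0, ∞)`, so `c` below would not make sense.
    rcases hκ.eq_or_lt with h0 | hκpos
    · have hset : {a | t ≤ f a} = (Set.Iic (0 : ℝ))ᶜ := by
        ext w
        simp only [Set.mem_ofPred_eq, hmem, Set.mem_compl_iff, Set.mem_Iic, not_le, ← h0]
        simp [ht.2]
      rw [hset, probReal_compl_eq_one_sub measurableSet_Iic,
        probReal_compl_eq_one_sub measurableSet_Iic, ← cdf_eq_real, ← cdf_eq_real]
      have h1 := h 0
      rw [abs_sub_comm] at h1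
      rw [sub_sub_sub_cancel_left]
      linarith [abs_nonneg (cdf γ 0 - cdf ν 0)]
    · set c := -Real.log t / κ with hc
      have hc0 : 0 ≤ c := div_nonneg (neg_nonneg.2 (Real.log_nonpos ht.1.le ht.2)) hκ
      have hset : {a | t ≤ f a} = Set.Iic c \ Set.Iic 0 := by
        ext w
        simp only [Set.mem_ofPred_eq, hmem, Set.mem_sdiff, Set.mem_Iic, not_le]
        rw [and_comm, ← Real.log_le_iff_le_exp ht.1, hc, le_div_iff₀ hκpos]
        constructor <;> rintro ⟨h1, h2⟩ <;> exact ⟨by linarith, h2⟩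
      have hsub : Set.Iic (0 : ℝ) ⊆ Set.Iic c := Set.Iic_subset_Iic.2 hc0
      rw [hset, measureReal_sdiff hsub measurableSet_Iic, measureReal_sdiff hsub measurableSet_Iic,
        ← cdf_eq_real, ← cdf_eq_real, ← cdf_eq_real, ← cdf_eq_real]
      have h1 := abs_le.1 (h 0)
      have h2 := abs_le.1 (h c)
      rw [abs_le]
      constructor <;> linarith [h1.1, h1.2, h2.1, h2.2]
  have := norm_setIntegral_le_of_norm_le_const (μ := volume) (s := Set.Ioc (0 : ℝ) 1) (by simp) hbound
  simpa using this

lemma setIntegral_exp_gaussianReal (κ : ℝ) {v : NNReal} (hv : v ≠ 0) :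
    ∫ w in Set.Ioi 0, Real.exp (-(κ * w)) ∂gaussianReal 0 v = mills (κ * √v) := by
  have hpos : 0 < √(v : ℝ) := Real.sqrt_pos.2 (by exact_mod_cast pos_iff_ne_zero.2 hv)
  have h1 : gaussianReal 0 v = (gaussianReal 0 1).map (√(v : ℝ) * ·) := by
    rw [gaussianReal_map_const_mul]
    congr 1
    · simp
    · ext; simp
  rw [h1, setIntegral_map measurableSet_Ioi (by fun_prop) (by fun_prop), mills]
  have h2 : (fun x => √(v : ℝ) * x) ⁻¹' Set.Ioi 0 = Set.Ioi 0 := by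
    ext x; simp [hpos]
  rw [h2]
  congr 1 with z
  rw [mul_assoc]

lemma cdf_gaussianReal_sub_le {v : NNReal} (hv : v ≠ 0) {x y : ℝ} (hxy : x ≤ y) :
    cdf (gaussianReal 0 v) y - cdf (gaussianReal 0 v) x ≤ (√v)⁻¹ * (y - x) := by
  have h1 : cdf (gaussianReal 0 v) y - cdf (gaussianReal 0 v) x
      = ∫ z in Set.Ioc x y, gaussianPDFReal 0 v z := by
    rw [cdf_eq_real, cdf_eq_real, ← measureReal_sdiff (Set.Iic_subset_Iic.2 hxy) measurableSet_Iic,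
      show Set.Iic y \ Set.Iic x = Set.Ioc x y by ext; simp [and_comm],
      measureReal_def, gaussianReal_apply_eq_integral _ hv,
      ENNReal.toReal_ofReal (integral_nonneg fun z => gaussianPDFReal_nonneg _ _ _)]
  have hpos : 0 < √(v : ℝ) := Real.sqrt_pos.2 (by exact_mod_cast pos_iff_ne_zero.2 hv)
  have h2 : ∀ z ∈ Set.Ioc x y, ‖gaussianPDFReal 0 v z‖ ≤ (√v)⁻¹ := by
    intro z _
    rw [Real.norm_of_nonneg (gaussianPDFReal_nonneg _ _ _), gaussianPDFReal]
    have h3 : Real.exp (-(z - 0) ^ 2 / (2 * v)) ≤ 1 := by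
      rw [Real.exp_le_one_iff, neg_div, neg_nonpos]
      positivity
    have h4 : (√(2 * Real.pi * v))⁻¹ ≤ (√v)⁻¹ := by
      refine inv_anti₀ hpos (Real.sqrt_le_sqrt ?_)
      have : (1 : ℝ) ≤ 2 * Real.pi := by linarith [Real.pi_gt_three]
      nlinarith [v.coe_nonneg]
    calc _ ≤ (√(2 * Real.pi * v))⁻¹ * 1 := by gcongr
      _ ≤ _ := by rw [mul_one]; exact h4
  have h5 := norm_setIntegral_le_of_norm_le_const (μ := volume) (s := Set.Ioc x y) (by simp) h2
  rw [h1]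
  refine (le_abs_self _).trans ?_
  rw [← Real.norm_eq_abs]
  simpa [hxy] using h5

/-! ### Exponential tilting -/

/-- `ν` has cumulant generating function `V φ` on the disc of radius `R`. -/
def HasCGFOnBall (ν : Measure ℝ) (V : ℝ) (φ : ℂ → ℂ) (R : ℝ) : Prop :=
  ∀ z ∈ Metric.ball (0 : ℂ) R, Integrable (fun x : ℝ => Complex.exp (z * x)) ν ∧
    ∫ x : ℝ, Complex.exp (z * x) ∂ν = Complex.exp (V * φ z)

/-- The law of `c (X - m)` when `X` has the exponentially tilted law `exp (s x) ν(dx)`,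
normalized. -/
def tiltedLaw (ν : Measure ℝ) (s c m : ℝ) : Measure ℝ :=
  (ν.tilted fun x => s * x).map fun x => c * (x - m)

namespace HasCGFOnBall

variable {ν : Measure ℝ} {V R : ℝ} {φ : ℂ → ℂ} (h : HasCGFOnBall ν V φ R)
include h

lemma integrable_exp {s : ℝ} (hs : (s : ℂ) ∈ Metric.ball (0 : ℂ) R) :
    Integrable (fun x : ℝ => Real.exp (s * x)) ν := by
  refine (h s hs).1.norm.congr (ae_of_all _ fun x => ?_)
  simp only [Complex.norm_exp]
  simp

lemma integral_exp {s : ℝ} (hs : (s : ℂ) ∈ Metric.ball (0 : ℂ) R) :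
    ∫ x : ℝ, Real.exp (s * x) ∂ν = Real.exp (V * (φ s).re) := by
  have h1 : ((∫ x : ℝ, Real.exp (s * x) ∂ν : ℝ) : ℂ) = Complex.exp (V * φ s) := by
    rw [← (h s hs).2, ← integral_complex_ofReal]
    simp
  have h2 := congrArg norm h1
  rw [Complex.norm_real, Real.norm_of_nonneg (integral_nonneg fun x => (Real.exp_pos _).le),
    Complex.norm_exp, Complex.re_ofReal_mul] at h2
  exact h2

lemma isProbabilityMeasure_tiltedLaw [IsProbabilityMeasure ν] {s : ℝ}
    (hs : (s : ℂ) ∈ Metric.ball (0 : ℂ) R) (c m : ℝ) : IsProbabilityMeasure (tiltedLaw ν s c m) := by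
  have := isProbabilityMeasure_tilted (h.integrable_exp hs)
  exact Measure.isProbabilityMeasure_map (by fun_prop)

lemma charFun_tiltedLaw [IsProbabilityMeasure ν] {s : ℝ}
    (hs : (s : ℂ) ∈ Metric.ball (0 : ℂ) R) (c m t : ℝ)
    (hst : (s : ℂ) + (c * t : ℝ) * Complex.I ∈ Metric.ball (0 : ℂ) R) :
    charFun (tiltedLaw ν s c m) t
      = Complex.exp (V * (φ (s + (c * t : ℝ) * Complex.I) - φ s) - (c * t * m : ℝ) * Complex.I) := by
  have hZ : ((Real.exp (V * (φ s).re) : ℝ) : ℂ) = Complex.exp (V * φ s) := by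
    rw [← h.integral_exp hs, ← (h s hs).2, ← integral_complex_ofReal]
    simp
  rw [charFun_apply_real, tiltedLaw, integral_map (by fun_prop) (by fun_prop), integral_tilted,
    h.integral_exp hs]
  have h1 : ∀ x : ℝ, (Real.exp (s * x) / Real.exp (V * (φ s).re)) •
      Complex.exp (t * ((c * (x - m) : ℝ) : ℂ) * Complex.I)
      = Complex.exp (-(V * φ s) - (c * t * m : ℝ) * Complex.I) *
        Complex.exp ((s + (c * t : ℝ) * Complex.I) * x) := by
    intro x
    rw [Complex.real_smul, Complex.ofReal_div, hZ, Complex.ofReal_exp, ← Complex.exp_sub,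
      ← Complex.exp_add, ← Complex.exp_add]
    congr 1
    push_cast
    ring
  simp_rw [h1]
  rw [integral_const_mul, (h _ hst).2, ← Complex.exp_add]
  congr 1
  ring

/-- Exact inversion of the tilt. The scale `c` is free; it is later chosen so that unit frequencies
of the rescaled law stay inside the disc of analyticity. -/
lemma measureReal_Ioi_eq [IsProbabilityMeasure ν] {s c : ℝ}
    (hs : (s : ℂ) ∈ Metric.ball (0 : ℂ) R) (hc : 0 < c) (m : ℝ) :
    ν.real (Set.Ioi m) = Real.exp (V * (φ s).re - s * m) *
      ∫ w in Set.Ioi 0, Real.exp (-(s / c * w)) ∂tiltedLaw ν s c m := by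
  have hpre : (fun x => c * (x - m)) ⁻¹' Set.Ioi 0 = Set.Ioi m := by
    ext x; simp [hc]
  rw [tiltedLaw, setIntegral_map measurableSet_Ioi (by fun_prop) (by fun_prop), hpre,
    setIntegral_tilted, h.integral_exp hs, ← integral_const_mul]
  have h1 : ∀ x : ℝ, Real.exp (V * (φ s).re - s * m) *
      ((Real.exp (s * x) / Real.exp (V * (φ s).re)) • Real.exp (-(s / c * (c * (x - m))))) = 1 := by
    intro x
    rw [smul_eq_mul, ← Real.exp_sub, ← Real.exp_add, ← Real.exp_add, Real.exp_eq_one_iff]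
    field_simp
    ring
  simp_rw [h1]
  simp

end HasCGFOnBall

/-! ### Taylor bounds and Gaussian approximation of the tilted law -/

namespace IsNormalizedCGF

variable {φ : ℂ → ℂ} {R A : ℝ} (h : IsNormalizedCGF φ R A)
include h

/-- Mean value inequality with the Lipschitz bound on `φ''`. The domain is cut with the closed ball
of radius `‖z - s‖` about `s`, so that the derivative is at most `A * ‖z - s‖` there. -/
lemma norm_deriv_taylor_le (hA : 0 ≤ A) {z s : ℂ} (hz : z ∈ Metric.ball (0 : ℂ) R)
    (hs : s ∈ Metric.ball (0 : ℂ) R) :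
    ‖deriv φ z - deriv φ s - (z - s) * deriv (deriv φ) s‖ ≤ A * ‖z - s‖ ^ 2 := by
  have key := Convex.norm_image_sub_le_of_norm_hasDerivWithin_le (𝕜 := ℂ)
    (f := fun w => deriv φ w - w * deriv (deriv φ) s)
    (f' := fun w => deriv (deriv φ) w - 1 * deriv (deriv φ) s) (C := A * ‖z - s‖)
    (s := Metric.ball (0 : ℂ) R ∩ Metric.closedBall s ‖z - s‖) (x := s) (y := z)
    (fun w hw => ((h.hasDerivAt_deriv hw.1).sub
      ((hasDerivAt_id w).mul_const _)).hasDerivWithinAt)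
    (fun w hw => by
      rw [one_mul]
      refine (h.lipschitz w hw.1 s hs).trans ?_
      gcongr
      exact mem_closedBall_iff_norm.1 hw.2)
    ((convex_ball _ _).inter (convex_closedBall _ _)) ⟨hs, Metric.mem_closedBall_self (norm_nonneg _)⟩
    ⟨hz, mem_closedBall_iff_norm.2 le_rfl⟩
  calc _ = ‖deriv φ z - z * deriv (deriv φ) s - (deriv φ s - s * deriv (deriv φ) s)‖ := by
        congr 1; ring
    _ ≤ A * ‖z - s‖ * ‖z - s‖ := key
    _ = _ := by ring

lemma norm_taylor_le (hA : 0 ≤ A) {z s : ℂ} (hz : z ∈ Metric.ball (0 : ℂ) R)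
    (hs : s ∈ Metric.ball (0 : ℂ) R) :
    ‖φ z - φ s - (z - s) * deriv φ s - (z - s) ^ 2 / 2 * deriv (deriv φ) s‖ ≤ A * ‖z - s‖ ^ 3 := by
  have key := Convex.norm_image_sub_le_of_norm_hasDerivWithin_le (𝕜 := ℂ)
    (f := fun w => φ w - (w - s) * deriv φ s - (w - s) ^ 2 / 2 * deriv (deriv φ) s)
    (f' := fun w => deriv φ w - deriv φ s - (w - s) * deriv (deriv φ) s) (C := A * ‖z - s‖ ^ 2)
    (s := Metric.ball (0 : ℂ) R ∩ Metric.closedBall s ‖z - s‖) (x := s) (y := z)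
    (fun w hw => by
      have h1 : HasDerivAt (fun w => w - s) 1 w := (hasDerivAt_id w).sub_const s
      have h2 := ((h.hasDerivAt hw.1).sub (h1.mul_const (deriv φ s))).sub
        (((h1.pow 2).div_const 2).mul_const (deriv (deriv φ) s))
      refine HasDerivAt.hasDerivWithinAt ?_
      convert! h2 using 1
      simp)
    (fun w hw => by
      refine (h.norm_deriv_taylor_le hA hw.1 hs).trans ?_
      gcongr
      exact mem_closedBall_iff_norm.1 hw.2)
    ((convex_ball _ _).inter (convex_closedBall _ _)) ⟨hs, Metric.mem_closedBall_self (norm_nonneg _)⟩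
    ⟨hz, mem_closedBall_iff_norm.2 le_rfl⟩
  calc _ = ‖φ z - (z - s) * deriv φ s - (z - s) ^ 2 / 2 * deriv (deriv φ) s -
        (φ s - (s - s) * deriv φ s - (s - s) ^ 2 / 2 * deriv (deriv φ) s)‖ := by
        congr 1; ring
    _ ≤ A * ‖z - s‖ ^ 2 * ‖z - s‖ := key
    _ = _ := by ring

lemma deriv_deriv_ofReal (s : ℝ) :
    (((deriv (deriv φ) s).re : ℝ) : ℂ) = deriv (deriv φ) s := by
  have := h.deriv_deriv_conj s
  rw [Complex.conj_ofReal] at this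
  exact Complex.conj_eq_iff_re.1 this.symm

/-- The tilted law is nearly Gaussian on the Fourier side. -/
lemma norm_charFun_tiltedLaw_sub_le {ν : Measure ℝ} [IsProbabilityMeasure ν] {V s c : ℝ} {v : NNReal}
    (hcgf : HasCGFOnBall ν V φ R) (hV : 0 < V) (hA : 0 < A) (hs0 : 0 ≤ s) (hc : 0 < c)
    (hsc : s + c < R) (hAc : A * c ≤ 1 / 8) {y : ℝ} (hy : deriv φ s = y)
    (hhalf : 1 / 2 ≤ (deriv (deriv φ) s).re) (hv : (v : ℝ) = V * c ^ 2 * (deriv (deriv φ) s).re)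
    {t : ℝ} (ht : t ∈ Set.Icc (-1 : ℝ) 1) :
    ‖charFun (tiltedLaw ν s c (y * V)) (-t) - charFun (gaussianReal 0 v) (-t)‖
      ≤ |t| * (V * A * c ^ 3 * t ^ 2 * Real.exp (-(V * c ^ 2 / 8) * t ^ 2)) := by
  have htabs : |t| ≤ 1 := abs_le.2 ⟨ht.1, ht.2⟩
  have hsball : (s : ℂ) ∈ Metric.ball (0 : ℂ) R := by
    rw [mem_ball_zero_iff, Complex.norm_real, Real.norm_of_nonneg hs0]; linarith
  set ζ : ℂ := ((c * -t : ℝ) : ℂ) * Complex.I with hζ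
  have hζn : ‖ζ‖ = c * |t| := by
    rw [hζ, norm_mul, Complex.norm_I, mul_one, Complex.norm_real, Real.norm_eq_abs, abs_mul,
      abs_neg, abs_of_pos hc]
  have hζball : (s : ℂ) + ζ ∈ Metric.ball (0 : ℂ) R := by
    rw [mem_ball_zero_iff]
    refine (norm_add_le _ _).trans_lt ?_
    rw [hζn, Complex.norm_real, Real.norm_of_nonneg hs0]
    nlinarith
  -- Centring at `y V` cancels the linear term since `φ'(s) = y`, and the quadratic term is the
  -- Gaussian exponent; only the cubic remainder `e` is left.
  set e : ℂ := φ (s + ζ) - φ s - ζ * y - ζ ^ 2 / 2 * deriv (deriv φ) s with he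
  have hen : ‖e‖ ≤ A * (c * |t|) ^ 3 := by
    have := h.norm_taylor_le hA.le hζball hsball
    rw [add_sub_cancel_left, hy, hζn] at this
    exact this
  rw [hcgf.charFun_tiltedLaw hsball c _ _ hζball, charFun_gaussianReal]
  set a : ℝ := -(v * t ^ 2 / 2) with ha
  have hζ2 : ζ ^ 2 = -((c ^ 2 * t ^ 2 : ℝ) : ℂ) := by
    rw [hζ, mul_pow, Complex.I_sq]; push_cast; ring
  have hexp1 : (V : ℂ) * (φ (s + ζ) - φ s) - ((c * -t * (y * V) : ℝ) : ℂ) * Complex.I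
      = (a : ℂ) + V * e := by
    have h1 : ((c * -t * (y * V) : ℝ) : ℂ) * Complex.I = V * (ζ * y) := by
      rw [hζ]; push_cast; ring
    have h2 : (a : ℂ) = V * (ζ ^ 2 / 2 * deriv (deriv φ) s) := by
      rw [hζ2, ← h.deriv_deriv_ofReal, ha, hv]; push_cast; ring
    rw [h1, h2, he]; ring
  have hexp2 : (((-t : ℝ) : ℂ) * (0 : ℝ) * Complex.I - v * ((-t : ℝ) : ℂ) ^ 2 / 2) = (a : ℂ) := by
    rw [ha]; push_cast; ring
  rw [hexp1, hexp2, Complex.exp_add, ← mul_sub_one, norm_mul, Complex.norm_exp, Complex.ofReal_re]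
  have hb : ‖Complex.exp (V * e) - 1‖ ≤ ‖(V : ℂ) * e‖ * Real.exp ‖(V : ℂ) * e‖ := by
    simpa using Complex.norm_exp_sub_sum_le_norm_mul_exp ((V : ℂ) * e) 1
  have hVe : ‖(V : ℂ) * e‖ ≤ V * (A * (c * |t|) ^ 3) := by
    rw [norm_mul, Complex.norm_real, Real.norm_of_nonneg hV.le]
    gcongr
  -- The choice `A * c ≤ 1 / 8` keeps the remainder below half of the Gaussian decay `V c² t² / 4`.
  have hVe2 : ‖(V : ℂ) * e‖ ≤ V * c ^ 2 / 8 * t ^ 2 := by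
    refine hVe.trans ?_
    calc V * (A * (c * |t|) ^ 3) = (V * c ^ 2 * |t| ^ 2) * ((A * c) * |t|) := by ring
      _ ≤ (V * c ^ 2 * |t| ^ 2) * (1 / 8 * 1) := by gcongr
      _ = _ := by rw [sq_abs]; ring
  have ha2 : a ≤ -(V * c ^ 2 / 4) * t ^ 2 := by
    rw [ha, hv]
    have : V * c ^ 2 * t ^ 2 * (1 / 2) ≤ V * c ^ 2 * t ^ 2 * (deriv (deriv φ) s).re := by gcongr
    linarith
  calc Real.exp a * ‖Complex.exp (V * e) - 1‖
      ≤ Real.exp (-(V * c ^ 2 / 4) * t ^ 2) *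
          (V * (A * (c * |t|) ^ 3) * Real.exp (V * c ^ 2 / 8 * t ^ 2)) := by
        gcongr
        exact hb.trans (by gcongr)
    _ = V * (A * (c * |t|) ^ 3) *
          (Real.exp (-(V * c ^ 2 / 4) * t ^ 2) * Real.exp (V * c ^ 2 / 8 * t ^ 2)) := by ring
    _ = V * (A * (c * |t|) ^ 3) * Real.exp (-(V * c ^ 2 / 8) * t ^ 2) := by
        rw [← Real.exp_add]; ring_nf
    _ = _ := by rw [mul_pow, pow_succ |t|, sq_abs]; ring

end IsNormalizedCGF

/-- The factor `t²` is absorbed by `u ≤ exp u` at the cost of half of the exponent; a Gaussian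
integral remains. -/
lemma integral_sq_mul_exp_le {A c V : ℝ} (hA : 0 < A) (hc : 0 < c) (hV : 0 < V) :
    ∫ t in (-1 : ℝ)..1, V * A * c ^ 3 * t ^ 2 * Real.exp (-(V * c ^ 2 / 8) * t ^ 2)
      ≤ 64 * A * √Real.pi / √V := by
  have hβ : 0 < V * c ^ 2 / 16 := by positivity
  have hle : ∀ t : ℝ, V * A * c ^ 3 * t ^ 2 * Real.exp (-(V * c ^ 2 / 8) * t ^ 2)
      ≤ 16 * A * c * Real.exp (-(V * c ^ 2 / 16) * t ^ 2) := by
    intro t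
    have h1 : V * c ^ 2 / 16 * t ^ 2 ≤ Real.exp (V * c ^ 2 / 16 * t ^ 2) :=
      (by linarith : V * c ^ 2 / 16 * t ^ 2 ≤ V * c ^ 2 / 16 * t ^ 2 + 1).trans
        (Real.add_one_le_exp _)
    calc V * A * c ^ 3 * t ^ 2 * Real.exp (-(V * c ^ 2 / 8) * t ^ 2)
        = 16 * A * c * (V * c ^ 2 / 16 * t ^ 2 * Real.exp (-(V * c ^ 2 / 8) * t ^ 2)) := by ring
      _ ≤ 16 * A * c * (Real.exp (V * c ^ 2 / 16 * t ^ 2) * Real.exp (-(V * c ^ 2 / 8) * t ^ 2)) := by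
          gcongr
      _ = _ := by rw [← Real.exp_add]; ring_nf
  have hint : Integrable fun t : ℝ => 16 * A * c * Real.exp (-(V * c ^ 2 / 16) * t ^ 2) :=
    (integrable_exp_neg_mul_sq hβ).const_mul _
  calc _ ≤ ∫ t in (-1 : ℝ)..1, 16 * A * c * Real.exp (-(V * c ^ 2 / 16) * t ^ 2) :=
        intervalIntegral.integral_mono_on (by norm_num)
          (Continuous.intervalIntegrable (by fun_prop) _ _)
          (Continuous.intervalIntegrable (by fun_prop) _ _) fun t _ => hle t
    _ ≤ ∫ t : ℝ, 16 * A * c * Real.exp (-(V * c ^ 2 / 16) * t ^ 2) := by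
        rw [intervalIntegral.integral_of_le (by norm_num)]
        exact setIntegral_le_integral hint (ae_of_all _ fun t => by positivity)
    _ = 64 * A * √Real.pi / √V := by
        rw [integral_const_mul, integral_gaussian,
          show Real.pi / (V * c ^ 2 / 16) = (4 / c) ^ 2 * (Real.pi / V) by field_simp; norm_num,
          Real.sqrt_mul (by positivity), Real.sqrt_sq (by positivity), Real.sqrt_div Real.pi_pos.le]
        field_simp
        norm_num

/-! ### Cramér's expansion -/

/-- With `q = φ''(s)`, both `√q - 1 = O(s)` and `y - s = O(s²)`, so the two arguments agree up to
the factor `1 + O(y)`, whatever `V` is. -/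
lemma abs_mills_div_mills_sub_one_le {A s y q V : ℝ} (hA : 0 < A) (hs0 : 0 ≤ s) (hs2 : s ≤ 2 * y)
    (hys : y ≤ 2 * s) (hq0 : 0 < q) (hqs : |q - 1| ≤ A * s) (hys2 : |y - s| ≤ A * s ^ 2)
    (hy2 : A * y ≤ 1 / 16) (hV : 0 < V) :
    |mills (s * √(V * q)) / mills (y * √V) - 1| ≤ 16 * A * y := by
  have hsV : 0 < √V := Real.sqrt_pos.2 hV
  rcases hs0.eq_or_lt with hs' | hs'
  · have hy' : y = 0 := by linarith
    rw [← hs', hy']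
    simp [(mills_pos 0).ne']
  have hypos : 0 < y := by linarith
  have hxpos : 0 < y * √V := by positivity
  have h1 : s * √(V * q) / (y * √V) - 1 = (s * √q - y) / y := by
    rw [Real.sqrt_mul hV.le]
    field_simp
  have h2 : |√q - 1| ≤ |q - 1| := by
    have h3 : q - 1 = (√q - 1) * (√q + 1) := by
      linear_combination -Real.sq_sqrt hq0.le
    rw [h3, abs_mul, abs_of_pos (by positivity : 0 < √q + 1)]
    exact le_mul_of_one_le_right (abs_nonneg _) (by linarith [Real.sqrt_nonneg q])
  have h4 : |s * √q - y| ≤ 2 * A * s ^ 2 := by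
    have h5 : s * √q - y = s * (√q - 1) - (y - s) := by ring
    rw [h5]
    refine (abs_sub _ _).trans ?_
    rw [abs_mul, abs_of_pos hs']
    have h6 : s * |√q - 1| ≤ s * (A * s) := mul_le_mul_of_nonneg_left (h2.trans hqs) hs0
    linarith
  have h6 : |s * √(V * q) / (y * √V) - 1| ≤ 8 * A * y := by
    rw [h1, abs_div, abs_of_pos hypos, div_le_iff₀ hypos]
    have h7 : s ^ 2 ≤ (2 * y) ^ 2 := pow_le_pow_left₀ hs0 hs2 2
    have h8 : 2 * A * s ^ 2 ≤ 2 * A * (2 * y) ^ 2 := by gcongr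
    linarith
  exact (abs_mills_div_sub_one_le hxpos (by linarith) h6).trans (le_of_eq (by ring))

/-- A Berry–Esseen bound for the Laplace transform of the positive part of the tilted law. -/
lemma IsNormalizedCGF.abs_laplace_tiltedLaw_sub_le {φ : ℂ → ℂ} {R A : ℝ} (h : IsNormalizedCGF φ R A)
    {ν : Measure ℝ} [IsProbabilityMeasure ν] {V s c : ℝ}
    (hcgf : HasCGFOnBall ν V φ R) (hV : 0 < V) (hA : 0 < A) (hs0 : 0 ≤ s) (hc : 0 < c)
    (hsc : s + c < R) (hAc : A * c ≤ 1 / 8) {y : ℝ} (hy : deriv φ s = y)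
    (hhalf : 1 / 2 ≤ (deriv (deriv φ) s).re) :
    |(∫ w in Set.Ioi 0, Real.exp (-(s / c * w)) ∂tiltedLaw ν s c (y * V))
        - mills (s * √(V * (deriv (deriv φ) s).re))|
      ≤ 2 * (4 / (∫ s, fejer s) * (2 * (64 * A * √Real.pi) + 80 * (2 / c)) / √V) := by
  have hI := integral_fejer_pos
  set q := (deriv (deriv φ) s).re with hq
  have hq0 : 0 < q := by linarith
  have hsball : (s : ℂ) ∈ Metric.ball (0 : ℂ) R := by
    rw [mem_ball_zero_iff, Complex.norm_real, Real.norm_of_nonneg hs0]; linarith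
  obtain ⟨v, hv⟩ : ∃ v : NNReal, (v : ℝ) = V * c ^ 2 * q := ⟨⟨V * c ^ 2 * q, by positivity⟩, rfl⟩
  have hv0 : v ≠ 0 := by
    rw [← NNReal.coe_ne_zero, hv]; positivity
  have hsqrtv : √(v : ℝ) = c * √(V * q) := by
    rw [hv, show V * c ^ 2 * q = c ^ 2 * (V * q) by ring, Real.sqrt_mul (by positivity),
      Real.sqrt_sq hc.le]
  have hsV : 0 < √V := Real.sqrt_pos.2 hV
  have := hcgf.isProbabilityMeasure_tiltedLaw hsball c (y * V)
  have hm : (√(v : ℝ))⁻¹ ≤ 2 / c / √V := by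
    have hpos : 0 < √(V * q) := Real.sqrt_pos.2 (by positivity)
    rw [hsqrtv, div_div, ← one_div, div_le_div_iff₀ (by positivity) (by positivity)]
    have h1 : √V ≤ 2 * √(V * q) := by
      rw [show (2 : ℝ) = √(2 ^ 2) by rw [Real.sqrt_sq]; norm_num, ← Real.sqrt_mul (by norm_num)]
      exact Real.sqrt_le_sqrt (by nlinarith)
    calc 1 * (c * √V) = c * √V := one_mul _
      _ ≤ c * (2 * √(V * q)) := by gcongr
      _ = _ := by ring
  have hcdf : ∀ x, |cdf (tiltedLaw ν s c (y * V)) x - cdf (gaussianReal 0 v) x|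
      ≤ 4 / (∫ s, fejer s) * (2 * (64 * A * √Real.pi) + 80 * (2 / c)) / √V := by
    intro x
    refine (abs_cdf_sub_cdf_le _ _
      (G := fun t => V * A * c ^ 3 * t ^ 2 * Real.exp (-(V * c ^ 2 / 8) * t ^ 2)) (by fun_prop)
      (m := (√(v : ℝ))⁻¹)
      (inv_pos.2 (by rw [hsqrtv]; positivity)) (fun x y hxy => cdf_gaussianReal_sub_le hv0 hxy)
      (fun t ht => h.norm_charFun_tiltedLaw_sub_le hcgf hV hA hs0 hc hsc hAc hy hhalf hv ht)
      x).trans ?_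
    have h1 := integral_sq_mul_exp_le hA hc hV
    calc _ ≤ 4 / (∫ s, fejer s) * (2 * (64 * A * √Real.pi / √V) + 80 * (2 / c / √V)) := by
          gcongr
      _ = _ := by ring
  have hlap := abs_setIntegral_exp_sub_le (tiltedLaw ν s c (y * V)) (gaussianReal 0 v)
    (κ := s / c) (by positivity) hcdf
  rwa [setIntegral_exp_gaussianReal _ hv0, hsqrtv, ← mul_assoc, div_mul_cancel₀ _ hc.ne'] at hlap

/-- **Cramér's large deviation expansion** for a law with cumulant generating function `V φ`,
uniformly over normalized `φ`. -/
theorem exists_cramer_expansion {R A : ℝ} (hR : 0 < R) (hA : 0 < A) :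
    ∃ δ > 0, ∃ D : ℝ, ∀ φ : ℂ → ℂ, IsNormalizedCGF φ R A →
      ∀ (ν : Measure ℝ) [IsProbabilityMeasure ν] (V : ℝ), 0 < V → HasCGFOnBall ν V φ R →
      ∀ y : ℝ, 0 ≤ y → y < δ →
        |ν.real (Set.Ioi (y * V)) / ((1 - stdNormalCDF (y * √V)) *
          Real.exp (V * (y ^ 3 * ∑' k, cramerCoeff φ k * y ^ k))) - 1| ≤ D * (y + 1 / √V) := by
  obtain ⟨ρ, hρ, _, hser⟩ := exists_cramerSeries hR hA
  set c := min (R / 2) (1 / (8 * A)) with hcdef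
  have hc : 0 < c := lt_min (by positivity) (by positivity)
  have hcR : c ≤ R / 2 := min_le_left _ _
  have hAc : A * c ≤ 1 / 8 := by
    calc A * c ≤ A * (1 / (8 * A)) := by gcongr; exact min_le_right _ _
      _ = 1 / 8 := by field_simp
  obtain ⟨C, hC⟩ : ∃ C, C = 4 / (∫ s, fejer s) * (2 * (64 * A * √Real.pi) + 80 * (2 / c)) :=
    ⟨_, rfl⟩
  have hC0 : 0 < C := by
    have hI := integral_fejer_pos
    rw [hC]; positivity
  set δ := min ρ (min (c / 4) (1 / (16 * A))) with hδ
  have hδpos : 0 < δ := lt_min hρ (lt_min (by positivity) (by positivity))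
  have hm1 := mills_pos 1
  refine ⟨δ, hδpos, 16 * A + 2 * C / mills 1, fun φ h ν _ V hV hcgf y hy0 hyδ => ?_⟩
  obtain ⟨s, hs0, hs2, hys, hsy, hleg⟩ := (hser φ h).2 y hy0 (hyδ.trans_le (min_le_left _ _))
  have hy1 : y < c / 4 := hyδ.trans_le ((min_le_right _ _).trans (min_le_left _ _))
  have hy2 : A * y ≤ 1 / 16 := by
    calc A * y ≤ A * (1 / (16 * A)) := by
          gcongr; exact hyδ.le.trans ((min_le_right _ _).trans (min_le_right _ _))
      _ = 1 / 16 := by field_simp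
  have hsR : s + c < R := by linarith
  have hsball : (s : ℂ) ∈ Metric.ball (0 : ℂ) R := by
    rw [mem_ball_zero_iff, Complex.norm_real, Real.norm_of_nonneg hs0]; linarith
  have h0ball : (0 : ℂ) ∈ Metric.ball (0 : ℂ) R := Metric.mem_ball_self hR
  have hqs : |(deriv (deriv φ) s).re - 1| ≤ A * s := by
    have h1 := h.norm_deriv_deriv_sub_one_le hR le_rfl hsball
    rw [← h.deriv_deriv_ofReal, Complex.norm_real, Real.norm_of_nonneg hs0,
      ← Complex.ofReal_one, ← Complex.ofReal_sub, Complex.norm_real, Real.norm_eq_abs] at h1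
    exact h1
  have hAs : A * s ≤ 1 / 8 := by
    calc A * s ≤ A * (2 * y) := by gcongr
      _ ≤ 1 / 8 := by linarith
  have hqhalf : 1 / 2 ≤ (deriv (deriv φ) s).re := by linarith [(abs_le.1 hqs).1]
  have hys2 : |y - s| ≤ A * s ^ 2 := by
    have h1 := h.norm_deriv_taylor_le hA.le hsball h0ball
    rw [hsy, h.deriv_zero, h.deriv_deriv_zero, sub_zero, sub_zero, mul_one, ← Complex.ofReal_sub,
      Complex.norm_real, Complex.norm_real, Real.norm_eq_abs, Real.norm_of_nonneg hs0] at h1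
    exact h1
  have hsV : 0 < √V := Real.sqrt_pos.2 hV
  have hlap := h.abs_laplace_tiltedLaw_sub_le hcgf hV hA hs0 hc hsR hAc hsy hqhalf
  have hmain := abs_mills_div_mills_sub_one_le hA hs0 hs2 hys (by linarith) hqs hys2 hy2 hV
  rw [← hC] at hlap
  generalize mills (s * √(V * (deriv (deriv φ) s).re)) = M at hlap hmain
  have hmx := mills_pos (y * √V)
  -- The Legendre identity turns the normal tail times the Cramér factor into the prefactor of the
  -- tilting formula, so only a ratio of Laplace transforms remains.
  have hden : (1 - stdNormalCDF (y * √V)) * Real.exp (V * (y ^ 3 * ∑' k, cramerCoeff φ k * y ^ k))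
      = Real.exp (V * (φ s).re - s * (y * V)) * mills (y * √V) := by
    rw [one_sub_stdNormalCDF, mul_right_comm, ← Real.exp_add]
    congr 2
    have h1 : y ^ 3 * ∑' k, cramerCoeff φ k * y ^ k = y ^ 2 / 2 - (s * y - (φ s).re) := by
      rw [hleg]; ring
    rw [h1, mul_pow, Real.sq_sqrt hV.le]
    ring
  rw [hden, hcgf.measureReal_Ioi_eq hsball hc, mul_div_mul_left _ _ (Real.exp_pos _).ne']
  generalize (∫ w in Set.Ioi 0, Real.exp (-(s / c * w)) ∂tiltedLaw ν s c (y * V)) = L at hlap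
  -- The error `2 C / √V`, divided by `mills 1 / (1 + y √V)`, is a multiple of `y + 1 / √V`.
  have herr : |L - M| / mills (y * √V) ≤ 2 * C / mills 1 * (y + 1 / √V) := by
    have h1 := mills_one_div_le (by positivity : 0 ≤ y * √V)
    calc |L - M| / mills (y * √V) ≤ (2 * (C / √V)) / (mills 1 / (1 + y * √V)) := by gcongr
      _ = 2 * C / mills 1 * (y + 1 / √V) := by field_simp; ring
  have hsplit : L / mills (y * √V) - 1 = (M / mills (y * √V) - 1) + (L - M) / mills (y * √V) := by
    field_simp; ring
  calc |L / mills (y * √V) - 1| ≤ |M / mills (y * √V) - 1| + |(L - M) / mills (y * √V)| := by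
        rw [hsplit]; exact abs_add_le _ _
    _ ≤ 16 * A * y + 2 * C / mills 1 * (y + 1 / √V) := by
        rw [abs_div, abs_of_pos hmx]
        exact add_le_add hmain herr
    _ ≤ _ := by
        have : 0 ≤ 16 * A * (1 / √V) := by positivity
        linarith

/-! ### Exponential generating series of cumulants -/

/-- The exponential generating series `∑ κ_k z^k / k!`. -/
def cumulantSeries (κ : ℕ → ℝ) (z : ℂ) : ℂ := ∑' k, ((κ k / k.factorial : ℝ) : ℂ) * z ^ k

lemma iteratedDeriv_eq_of_hasSum {f : ℂ → ℂ} {p : ℕ → ℂ}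
    (h : ∀ᶠ z in 𝓝 0, HasSum (fun n => p n * z ^ n) (f z)) (n : ℕ) :
    iteratedDeriv n f 0 = n.factorial * p n := by
  have h1 : HasFPowerSeriesAt f (FormalMultilinearSeries.ofScalars ℂ p) 0 := by
    rw [hasFPowerSeriesAt_iff]
    filter_upwards [h] with z hz
    simpa [FormalMultilinearSeries.coeff_ofScalars, mul_comm] using hz
  have h2 := h1.analyticAt.hasFPowerSeriesAt.eq_formalMultilinearSeries h1
  have h3 := congrArg (fun q => FormalMultilinearSeries.coeff q n) h2
  simp only [FormalMultilinearSeries.coeff_ofScalars] at h3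
  rw [← h3]
  have : (n.factorial : ℂ) ≠ 0 := by exact_mod_cast n.factorial_ne_zero
  field_simp

lemma cumulantSeries_term_le {κ : ℕ → ℝ} {A q : ℝ} (hq : 0 < q)
    (hκ : ∀ k, |κ k| / k.factorial ≤ A * q ^ k) (k : ℕ) {z : ℂ}
    (hz : z ∈ Metric.ball (0 : ℂ) (1 / (2 * q))) :
    ‖((κ k / k.factorial : ℝ) : ℂ) * z ^ k‖ ≤ A * (1 / 2) ^ k := by
  have hz' : ‖z‖ ≤ 1 / (2 * q) := (mem_ball_zero_iff.1 hz).le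
  rw [norm_mul, norm_pow, Complex.norm_real, Real.norm_eq_abs, abs_div, Nat.abs_cast]
  have hA : 0 ≤ A * q ^ k := le_trans (by positivity) (hκ k)
  calc |κ k| / k.factorial * ‖z‖ ^ k ≤ A * q ^ k * (1 / (2 * q)) ^ k := by
        gcongr
        exact hκ k
    _ = A * (1 / 2) ^ k := by
        rw [mul_assoc, ← mul_pow]
        congr 2
        field_simp

lemma hasSum_cumulantSeries {κ : ℕ → ℝ} {A q : ℝ} (hq : 0 < q)
    (hκ : ∀ k, |κ k| / k.factorial ≤ A * q ^ k) {z : ℂ}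
    (hz : z ∈ Metric.ball (0 : ℂ) (1 / (2 * q))) :
    HasSum (fun k => ((κ k / k.factorial : ℝ) : ℂ) * z ^ k) (cumulantSeries κ z) :=
  (Summable.of_norm_bounded ((summable_geometric_of_lt_one (by norm_num)
    (by norm_num : (1 / 2 : ℝ) < 1)).mul_left A)
    fun k => cumulantSeries_term_le hq hκ k hz).hasSum

lemma isNormalizedCGF_cumulantSeries {A q : ℝ} (hq : 0 < q) {κ : ℕ → ℝ} (h0 : κ 0 = 0)
    (h1 : κ 1 = 0) (h2 : κ 2 = 1) (hκ : ∀ k, |κ k| / k.factorial ≤ A * q ^ k) :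
    IsNormalizedCGF (cumulantSeries κ) (1 / (4 * q)) (12 * A / (1 / (8 * q)) ^ 3) := by
  have hgeom : Summable fun k : ℕ => A * (1 / 2 : ℝ) ^ k :=
    (summable_geometric_of_lt_one (by norm_num) (by norm_num)).mul_left A
  have hgsum : ∑' k : ℕ, A * (1 / 2 : ℝ) ^ k = 2 * A := by
    rw [tsum_mul_left, tsum_geometric_two]; ring
  have hsub : Metric.ball (0 : ℂ) (1 / (4 * q)) ⊆ Metric.ball 0 (1 / (2 * q)) :=
    Metric.ball_subset_ball (one_div_le_one_div_of_le (by positivity) (by linarith))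
  have hdiff : DifferentiableOn ℂ (cumulantSeries κ) (Metric.ball 0 (1 / (2 * q))) :=
    Complex.differentiableOn_tsum_of_summable_norm hgeom (fun k => by fun_prop) Metric.isOpen_ball
      fun k z hz => cumulantSeries_term_le hq hκ k hz
  have hbound : ∀ z ∈ Metric.ball (0 : ℂ) (1 / (2 * q)), ‖cumulantSeries κ z‖ ≤ 2 * A := by
    intro z hz
    rw [← hgsum]
    exact tsum_of_norm_bounded hgeom.hasSum fun k => cumulantSeries_term_le hq hκ k hz
  have hcoef : ∀ n : ℕ, iteratedDeriv n (cumulantSeries κ) 0 = κ n := by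
    intro n
    rw [iteratedDeriv_eq_of_hasSum (f := cumulantSeries κ)
      (p := fun k => ((κ k / k.factorial : ℝ) : ℂ)) ?_ n]
    · have : (n.factorial : ℂ) ≠ 0 := by exact_mod_cast n.factorial_ne_zero
      push_cast
      field_simp
    · filter_upwards [Metric.ball_mem_nhds (0 : ℂ) (by positivity : 0 < 1 / (2 * q))] with z hz
      exact hasSum_cumulantSeries hq hκ hz
  refine ⟨hdiff.mono hsub, ?_, ?_, ?_, ?_, ?_⟩
  · simpa [h0] using hcoef 0
  · simpa [h1] using hcoef 1
  · have := hcoef 2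
    rwa [iteratedDeriv_succ, iteratedDeriv_one, h2, Complex.ofReal_one] at this
  · have hd1 := hdiff.deriv Metric.isOpen_ball
    have hd2 := hd1.deriv Metric.isOpen_ball
    -- The Lipschitz constant of `φ''` is Cauchy's bound for the third derivative on circles of
    -- radius `1 / (8 q)`, with `3! * 2 A = 12 A`.
    have hd3 : ∀ z ∈ Metric.ball (0 : ℂ) (1 / (4 * q)),
        ‖deriv (deriv (deriv (cumulantSeries κ))) z‖ ≤ 12 * A / (1 / (8 * q)) ^ 3 := by
      intro z hz
      have hzsub : Metric.closedBall z (1 / (8 * q)) ⊆ Metric.ball 0 (1 / (2 * q)) := by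
        intro w hw
        rw [mem_ball_zero_iff] at hz ⊢
        rw [mem_closedBall_iff_norm] at hw
        have h3 : ‖w‖ ≤ ‖z‖ + ‖w - z‖ := by
          have := norm_add_le z (w - z); rwa [add_sub_cancel] at this
        have h4 : 1 / (4 * q) + 1 / (8 * q) < 1 / (2 * q) := by
          rw [← sub_pos]
          have : 1 / (2 * q) - (1 / (4 * q) + 1 / (8 * q)) = 1 / (8 * q) := by field_simp; norm_num
          rw [this]; positivity
        linarith
      have h3 := Complex.norm_iteratedDeriv_le_of_forall_mem_sphere_norm_le (c := z)
        (f := cumulantSeries κ) (C := 2 * A) 3 (by positivity : 0 < 1 / (8 * q)) ?_ ?_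
      · rw [iteratedDeriv_succ, iteratedDeriv_succ, iteratedDeriv_one] at h3
        refine h3.trans (le_of_eq ?_)
        norm_num [Nat.factorial]
        ring
      · refine DifferentiableOn.diffContOnCl (hdiff.mono ?_)
        exact (closure_mono Metric.ball_subset_closedBall).trans
          (Metric.isClosed_closedBall.closure_subset.trans hzsub)
      · exact fun w hw => hbound w (hzsub (Metric.sphere_subset_closedBall hw))
    intro z hz w hw
    exact Convex.norm_image_sub_le_of_norm_deriv_le (𝕜 := ℂ)
      (fun x hx => hd2.differentiableAt (Metric.isOpen_ball.mem_nhds (hsub hx))) hd3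
      (convex_ball _ _) hw hz
  · intro z
    rw [cumulantSeries, cumulantSeries, Complex.conj_tsum]
    refine tsum_congr fun k => ?_
    rw [map_mul, map_pow, Complex.conj_ofReal]

/-! ### Cumulants of a variable that satisfies Cramér's condition -/

lemma cumulant_const_mul {Ω : Type*} [MeasurableSpace Ω] (X : Ω → ℝ) (μ : Measure Ω) (b : ℝ)
    (k : ℕ) : cumulant (fun ω => b * X ω) μ k = b ^ k * cumulant X μ k := by
  have h1 : cgf (fun ω => b * X ω) μ = fun t => cgf X μ (b * t) := by
    ext t
    simp only [cgf, mgf]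
    congr 3 with ω
    ring_nf
  have h2 : ∀ k, iteratedDeriv k (fun t => cgf X μ (b * t))
      = fun t => b ^ k * iteratedDeriv k (cgf X μ) (b * t) := by
    intro k
    induction k with
    | zero => ext t; simp
    | succ k ih =>
      ext t
      rw [iteratedDeriv_succ, ih, deriv_const_mul_field,
        deriv_comp_mul_left b (iteratedDeriv k (cgf X μ)) t, ← iteratedDeriv_succ, smul_eq_mul]
      ring
  rw [cumulant, h1, h2, cumulant]
  simp

lemma cumulant_zero {Ω : Type*} [MeasurableSpace Ω] (X : Ω → ℝ) (μ : Measure Ω)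
    [IsProbabilityMeasure μ] : cumulant X μ 0 = 0 := by
  simp [cumulant]

namespace CramerCondition

variable {Ω : Type*} [MeasurableSpace Ω] {μ : Measure Ω} {X : Ω → ℝ} {H C : ℝ}
  (h : CramerCondition X μ H C)
include h

lemma integrable_exp_mul {t : ℝ} (ht : |t| < H) : Integrable (fun ω => Real.exp (t * X ω)) μ := by
  have h1 := (h.integrable t (by simpa using ht)).norm
  refine h1.congr (ae_of_all _ fun ω => ?_)
  simp [Complex.norm_exp]

lemma mem_interior_integrableExpSet {t : ℝ} (ht : |t| < H) :
    t ∈ interior (integrableExpSet X μ) := by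
  refine mem_interior.2 ⟨Set.Ioo (-H) H, fun s hs => ?_, isOpen_Ioo, abs_lt.1 ht⟩
  exact h.integrable_exp_mul (abs_lt.2 hs)

/-- A zero of the transform would give the principal logarithm its default value, so the identity is
not immediate. It holds near `0`, where the transform is near `1`, and extends by the identity
theorem. -/
lemma complexMGF_eq_exp [IsProbabilityMeasure μ] {z : ℂ} (hz : z ∈ Metric.ball (0 : ℂ) H) :
    complexMGF X μ z = Complex.exp (complexCGF X μ z) := by
  have hH : 0 < H := Metric.pos_of_mem_ball hz
  have h0 : (0 : ℂ) ∈ Metric.ball (0 : ℂ) H := Metric.mem_ball_self hH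
  have hre : ∀ w ∈ Metric.ball (0 : ℂ) H, |w.re| < H := fun w hw =>
    (Complex.abs_re_le_norm w).trans_lt (mem_ball_zero_iff.1 hw)
  have h1 : AnalyticOnNhd ℂ (complexMGF X μ) (Metric.ball (0 : ℂ) H) := fun w hw =>
    analyticAt_complexMGF (h.mem_interior_integrableExpSet (hre w hw))
  have h2 : AnalyticOnNhd ℂ (fun z => Complex.exp (complexCGF X μ z)) (Metric.ball (0 : ℂ) H) :=
    h.analytic.cexp
  refine h1.eqOn_of_preconnected_of_eventuallyEq h2 (convex_ball _ _).isPreconnected h0 ?_ hz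
  have h3 : complexMGF X μ 0 = 1 := by simp [complexMGF]
  have h4 : ∀ᶠ w in 𝓝 0, complexMGF X μ w ≠ 0 :=
    (h1 0 h0).continuousAt.eventually_ne (by rw [h3]; exact one_ne_zero)
  filter_upwards [h4] with w hw
  rw [complexCGF, Complex.exp_log hw]

/-- Differentiating along the real axis preserves realness; the induction therefore runs over all
real points of the disc, not only `0`. -/
lemma iteratedDeriv_complexCGF (k : ℕ) {x : ℝ} (hx : |x| < H) :
    iteratedDeriv k (complexCGF X μ) x = (iteratedDeriv k (cgf X μ) x : ℝ) := by
  induction k generalizing x with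
  | zero =>
    rw [iteratedDeriv_zero, iteratedDeriv_zero, complexCGF, complexMGF_ofReal, cgf,
      Complex.ofReal_log mgf_nonneg]
  | succ k ih =>
    have hxball : (x : ℂ) ∈ Metric.ball (0 : ℂ) H := by simpa using hx
    have hev : ∀ᶠ y : ℝ in 𝓝 x, |y| < H := (continuous_abs.tendsto x).eventually (gt_mem_nhds hx)
    have h1 : HasDerivAt (iteratedDeriv k (complexCGF X μ))
        (iteratedDeriv (k + 1) (complexCGF X μ) x) (x : ℂ) := by
      rw [iteratedDeriv_succ]
      rw [iteratedDeriv_eq_iterate]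
      exact ((h.analytic _ hxball).iterated_deriv k).differentiableAt.hasDerivAt
    have h2 : HasDerivAt (fun y : ℝ => ((iteratedDeriv k (cgf X μ) y : ℝ) : ℂ))
        (iteratedDeriv (k + 1) (complexCGF X μ) x) x := by
      refine h1.comp_ofReal.congr_of_eventuallyEq ?_
      filter_upwards [hev] with y hy using (ih hy).symm
    have h3 : HasDerivAt (iteratedDeriv k (cgf X μ))
        (iteratedDeriv (k + 1) (complexCGF X μ) x).re x := by
      have := Complex.reCLM.hasFDerivAt.comp_hasDerivAt x h2
      exact this
    have h4 := h3.ofReal_comp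
    rw [h2.unique h4, iteratedDeriv_succ (f := cgf X μ), h3.deriv]

lemma iteratedDeriv_complexCGF_zero (hH : 0 < H) (k : ℕ) :
    iteratedDeriv k (complexCGF X μ) 0 = (cumulant X μ k : ℝ) := by
  have := h.iteratedDeriv_complexCGF k (x := 0) (by simpa using hH)
  simpa [cumulant] using this

lemma abs_cumulant_le (hH : 0 < H) (k : ℕ) :
    |cumulant X μ k| / k.factorial ≤ C * (2 / H) ^ k := by
  have hsub : Metric.closedBall (0 : ℂ) (H / 2) ⊆ Metric.ball 0 H :=
    Metric.closedBall_subset_ball (by linarith)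
  have h1 := Complex.norm_iteratedDeriv_le_of_forall_mem_sphere_norm_le (c := 0)
    (f := complexCGF X μ) (C := C) k (by positivity : 0 < H / 2)
    (DifferentiableOn.diffContOnCl (h.analytic.differentiableOn.mono
      ((closure_mono Metric.ball_subset_closedBall).trans
        (Metric.isClosed_closedBall.closure_subset.trans hsub))))
    (fun w hw => (h.bound w (hsub (Metric.sphere_subset_closedBall hw))).le)
  rw [h.iteratedDeriv_complexCGF_zero hH, Complex.norm_real, Real.norm_eq_abs] at h1
  rw [div_le_iff₀ (by positivity)]
  refine h1.trans (le_of_eq ?_)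
  rw [div_pow, div_pow]
  field_simp

lemma hasSum_complexCGF {z : ℂ} (hz : z ∈ Metric.ball (0 : ℂ) H) :
    HasSum (fun k => ((cumulant X μ k / k.factorial : ℝ) : ℂ) * z ^ k) (complexCGF X μ z) := by
  have hH : 0 < H := Metric.pos_of_mem_ball hz
  have h1 := Complex.hasSum_taylorSeries_on_ball h.analytic.differentiableOn hz
  convert! h1 using 2 with k
  rw [h.iteratedDeriv_complexCGF_zero hH, sub_zero, smul_eq_mul, smul_eq_mul]
  push_cast
  ring

lemma cumulant_one [IsProbabilityMeasure μ] (hH : 0 < H) (hmean : ∫ ω, X ω ∂μ = 0) :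
    cumulant X μ 1 = 0 := by
  rw [cumulant, iteratedDeriv_one,
    deriv_cgf_zero (h.mem_interior_integrableExpSet (by simpa using hH)), hmean, zero_div]

lemma cumulant_two [IsProbabilityMeasure μ] (hH : 0 < H) (hX : AEMeasurable X μ)
    (hmean : ∫ ω, X ω ∂μ = 0) : cumulant X μ 2 = variance X μ := by
  have h0 := h.mem_interior_integrableExpSet (t := 0) (by simpa using hH)
  rw [cumulant, iteratedDeriv_two_cgf h0, deriv_cgf_zero h0, variance_of_integral_eq_zero hX hmean]
  simp [hmean]

end CramerCondition

/-! ### Limits of moment generating functions -/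

section MGFLimit

variable {Ω ι : Type*} [MeasurableSpace Ω] {μ : Measure Ω} {l : Filter ι} [l.NeBot]
  [l.IsCountablyGenerated] {f : ι → Ω → ℝ} {S : Ω → ℝ}

/-- Fatou's lemma along an almost surely convergent subsequence. -/
lemma lintegral_exp_le_of_tendsto_eLpNorm (hf : ∀ i, AEStronglyMeasurable (f i) μ)
    (hS : AEStronglyMeasurable S μ) (hfS : Tendsto (fun i => eLpNorm (f i - S) 2 μ) l (𝓝 0))
    {τ : ℝ} {K : ENNReal} (hK : ∀ i, ∫⁻ ω, ENNReal.ofReal (Real.exp (τ * f i ω)) ∂μ ≤ K) :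
    ∫⁻ ω, ENNReal.ofReal (Real.exp (τ * S ω)) ∂μ ≤ K := by
  obtain ⟨ns, -, hns⟩ :=
    (tendstoInMeasure_of_tendsto_eLpNorm two_ne_zero hf hS hfS).exists_seq_tendsto_ae'
  calc ∫⁻ ω, ENNReal.ofReal (Real.exp (τ * S ω)) ∂μ
      = ∫⁻ ω, liminf (fun n => ENNReal.ofReal (Real.exp (τ * f (ns n) ω))) atTop ∂μ := by
        refine lintegral_congr_ae ?_
        filter_upwards [hns] with ω hω
        refine (Tendsto.liminf_eq ?_).symm
        exact ((ENNReal.continuous_ofReal.comp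
          (by fun_prop : Continuous fun x : ℝ => Real.exp (τ * x))).tendsto _).comp hω
    _ ≤ liminf (fun n => ∫⁻ ω, ENNReal.ofReal (Real.exp (τ * f (ns n) ω)) ∂μ) atTop := by
        refine lintegral_liminf_le' fun n => ?_
        have := (hf (ns n)).aemeasurable
        fun_prop
    _ ≤ liminf (fun _ : ℕ => K) atTop := liminf_le_liminf (Eventually.of_forall fun n => hK _)
    _ = K := by simp

lemma integrable_exp_of_lintegral_le (hS : AEStronglyMeasurable S μ) {τ : ℝ} {K : ENNReal}
    (hKtop : K ≠ ⊤) (hK : ∫⁻ ω, ENNReal.ofReal (Real.exp (τ * S ω)) ∂μ ≤ K) :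
    Integrable (fun ω => Real.exp (τ * S ω)) μ := by
  have hm : AEStronglyMeasurable (fun ω => Real.exp (τ * S ω)) μ :=
    (by fun_prop : Continuous fun x : ℝ => Real.exp (τ * x)).comp_aestronglyMeasurable hS
  refine ⟨hm, ?_⟩
  rw [hasFiniteIntegral_iff_norm]
  refine lt_of_le_of_lt ?_ (hK.trans_lt hKtop.lt_top)
  simp

lemma integrable_cexp_of_integrable_exp (hS : AEStronglyMeasurable S μ) {z : ℂ}
    (h : Integrable (fun ω => Real.exp (z.re * S ω)) μ) :
    Integrable (fun ω => Complex.exp (z * S ω)) μ := by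
  refine h.mono' ?_ (ae_of_all _ fun ω => ?_)
  · exact (by fun_prop : Continuous fun x : ℝ => Complex.exp (z * x)).comp_aestronglyMeasurable hS
  · simp [Complex.norm_exp]

lemma norm_cexp_sub_cexp_le (a b : ℂ) :
    ‖Complex.exp a - Complex.exp b‖ ≤ (Real.exp a.re + Real.exp b.re) * ‖a - b‖ := by
  have key := Convex.norm_image_sub_le_of_norm_deriv_le (𝕜 := ℂ) (f := Complex.exp)
    (C := Real.exp (max a.re b.re)) (s := {w : ℂ | w.re ≤ max a.re b.re}) (x := b) (y := a)
    (fun w _ => Complex.differentiableAt_exp)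
    (fun w hw => by
      rw [Complex.deriv_exp, Complex.norm_exp]
      exact Real.exp_le_exp.2 hw)
    (convex_halfSpace_re_le _) (show b.re ≤ _ from le_max_right _ _)
    (show a.re ≤ _ from le_max_left _ _)
  refine key.trans (mul_le_mul_of_nonneg_right ?_ (norm_nonneg _))
  rcases max_cases a.re b.re with ⟨h, -⟩ | ⟨h, -⟩ <;> rw [h] <;>
    linarith [Real.exp_pos a.re, Real.exp_pos b.re]

lemma eLpNorm_exp_le {g : Ω → ℝ} {τ : ℝ} {K : ENNReal}
    (hK : ∫⁻ ω, ENNReal.ofReal (Real.exp (2 * τ * g ω)) ∂μ ≤ K) :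
    eLpNorm (fun ω => Real.exp (τ * g ω)) 2 μ ≤ K ^ (1 / 2 : ℝ) := by
  rw [eLpNorm_eq_lintegral_rpow_enorm_toReal two_ne_zero ENNReal.ofNat_ne_top]
  have h2 : (2 : ENNReal).toReal = 2 := rfl
  rw [h2]
  refine ENNReal.rpow_le_rpow (le_trans (le_of_eq ?_) hK) (by norm_num)
  refine lintegral_congr fun ω => ?_
  rw [Real.enorm_eq_ofReal (Real.exp_pos _).le, ENNReal.ofReal_rpow_of_pos (Real.exp_pos _),
    ← Real.exp_mul]
  congr 2
  ring

/-- If `f i → S` in `L²` and the exponential moments of order `2 Re z` are bounded, then the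
complex moment generating functions converge at `z`. -/
lemma tendsto_integral_cexp (hf : ∀ i, AEStronglyMeasurable (f i) μ)
    (hS : AEStronglyMeasurable S μ) (hfS : Tendsto (fun i => eLpNorm (f i - S) 2 μ) l (𝓝 0))
    {z : ℂ} {K K' : ENNReal} (hKtop : K ≠ ⊤) (hK'top : K' ≠ ⊤)
    (hK : ∀ i, ∫⁻ ω, ENNReal.ofReal (Real.exp (2 * z.re * f i ω)) ∂μ ≤ K)
    (hK' : ∀ i, ∫⁻ ω, ENNReal.ofReal (Real.exp (z.re * f i ω)) ∂μ ≤ K') :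
    Tendsto (fun i => ∫ ω, Complex.exp (z * f i ω) ∂μ) l (𝓝 (∫ ω, Complex.exp (z * S ω) ∂μ)) := by
  have hKS := lintegral_exp_le_of_tendsto_eLpNorm hf hS hfS hK
  have hKS' := lintegral_exp_le_of_tendsto_eLpNorm hf hS hfS hK'
  have hintS := integrable_cexp_of_integrable_exp hS (integrable_exp_of_lintegral_le hS hK'top hKS')
  have hintf := fun i => integrable_cexp_of_integrable_exp (hf i)
    (integrable_exp_of_lintegral_le (hf i) hK'top (hK' i))
  have hexpm : ∀ {g : Ω → ℝ}, AEStronglyMeasurable g μ →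
      AEStronglyMeasurable (fun ω => Real.exp (z.re * g ω)) μ := fun hg =>
    (by fun_prop : Continuous fun x : ℝ => Real.exp (z.re * x)).comp_aestronglyMeasurable hg
  set M : ENNReal := ‖z‖ₑ * (K ^ (1 / 2 : ℝ) + K ^ (1 / 2 : ℝ)) with hM
  have hMtop : M ≠ ⊤ := by
    have : K ^ (1 / 2 : ℝ) ≠ ⊤ := ENNReal.rpow_ne_top_of_nonneg (by norm_num) hKtop
    exact ENNReal.mul_ne_top enorm_ne_top (ENNReal.add_ne_top.2 ⟨this, this⟩)
  have hbound : ∀ i, ‖(∫ ω, Complex.exp (z * f i ω) ∂μ) - ∫ ω, Complex.exp (z * S ω) ∂μ‖ₑ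
      ≤ M * eLpNorm (f i - S) 2 μ := by
    intro i
    rw [← integral_sub (hintf i) hintS]
    refine (enorm_integral_le_lintegral_enorm _).trans ?_
    set g : Ω → ℝ := (fun ω => Real.exp (z.re * f i ω)) + fun ω => Real.exp (z.re * S ω) with hg
    have hgm : AEStronglyMeasurable g μ := (hexpm (hf i)).add (hexpm hS)
    have h1 : ∀ ω, ‖Complex.exp (z * f i ω) - Complex.exp (z * S ω)‖ₑ
        ≤ ‖z‖ₑ * ‖(g • (f i - S)) ω‖ₑ := by
      intro ω
      rw [← enorm_norm z, ← enorm_mul]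
      refine enorm_le_iff_norm_le.2 ?_
      refine (norm_cexp_sub_cexp_le _ _).trans (le_of_eq ?_)
      have hgpos : 0 ≤ g ω := by simp only [hg, Pi.add_apply]; positivity
      rw [Pi.smul_apply', smul_eq_mul, norm_mul, norm_mul, norm_norm, Real.norm_of_nonneg hgpos,
        ← mul_sub, ← Complex.ofReal_sub, norm_mul, Complex.norm_real, Pi.sub_apply]
      simp only [hg, Pi.add_apply, Complex.re_mul_ofReal]
      ring
    -- Cauchy–Schwarz separates `f i - S` from the exponentials; their `L²` norms are moments of
    -- order `2 Re z`.
    calc ∫⁻ ω, ‖Complex.exp (z * f i ω) - Complex.exp (z * S ω)‖ₑ ∂μ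
        ≤ ∫⁻ ω, ‖z‖ₑ * ‖(g • (f i - S)) ω‖ₑ ∂μ := lintegral_mono h1
      _ = ‖z‖ₑ * eLpNorm (g • (f i - S)) 1 μ := by
          rw [lintegral_const_mul' _ _ enorm_ne_top, eLpNorm_one_eq_lintegral_enorm]
      _ ≤ ‖z‖ₑ * (eLpNorm g 2 μ * eLpNorm (f i - S) 2 μ) := by
          gcongr
          exact eLpNorm_smul_le_mul_eLpNorm ((hf i).sub hS) hgm
      _ ≤ ‖z‖ₑ * ((K ^ (1 / 2 : ℝ) + K ^ (1 / 2 : ℝ)) * eLpNorm (f i - S) 2 μ) := by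
          gcongr
          exact (eLpNorm_add_le (hexpm (hf i)) (hexpm hS) one_le_two).trans
            (add_le_add (eLpNorm_exp_le (hK i)) (eLpNorm_exp_le hKS))
      _ = M * eLpNorm (f i - S) 2 μ := by rw [hM, mul_assoc]
  rw [tendsto_iff_edist_tendsto_0]
  refine tendsto_of_tendsto_of_tendsto_of_le_of_le (g := fun _ => 0)
    (h := fun i => M * eLpNorm (f i - S) 2 μ) tendsto_const_nhds ?_ (fun _ => zero_le)
    (fun i => by rw [edist_eq_enorm_sub]; exact hbound i)
  have := ENNReal.Tendsto.const_mul (a := M) hfS (Or.inr hMtop)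
  simpa using this

end MGFLimit

/-! ### Sums of independent variables under Cramér's condition -/

/-- Centring kills the terms of orders `0` and `1`, so a factor `‖w‖ ^ 2` comes out. For `w = z b_j`
it is summable over `j`. -/
lemma CramerCondition.norm_cumulant_term_le {Ω : Type*} [MeasurableSpace Ω] {μ : Measure Ω}
    [IsProbabilityMeasure μ] {X : Ω → ℝ} {H C : ℝ} (h : CramerCondition X μ H C) (hH : 0 < H)
    (hC : 0 < C) (hmean : ∫ ω, X ω ∂μ = 0) {w : ℂ} (hw : ‖w‖ ≤ H / 4) (k : ℕ) :
    ‖((cumulant X μ k / k.factorial : ℝ) : ℂ) * w ^ k‖ ≤ 16 * C / H ^ 2 * ‖w‖ ^ 2 * (1 / 2) ^ k := by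
  rw [norm_mul, norm_pow, Complex.norm_real, Real.norm_eq_abs, abs_div, Nat.abs_cast]
  match k with
  | 0 => rw [cumulant_zero]; simp; positivity
  | 1 => rw [h.cumulant_one hH hmean]; simp; positivity
  | k + 2 =>
    calc |cumulant X μ (k + 2)| / (k + 2).factorial * ‖w‖ ^ (k + 2)
        ≤ C * (2 / H) ^ (k + 2) * (‖w‖ ^ 2 * (H / 4) ^ k) := by
          rw [pow_add ‖w‖, mul_comm (‖w‖ ^ k)]
          gcongr
          exact h.abs_cumulant_le hH _
      _ = C * (2 / H) ^ 2 * ‖w‖ ^ 2 * ((2 / H) * (H / 4)) ^ k := by rw [mul_pow]; ring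
      _ = C * (2 / H) ^ 2 * ‖w‖ ^ 2 * (1 / 2) ^ k := by
          congr 2; field_simp; norm_num
      _ = _ := by rw [pow_add (1 / 2 : ℝ)]; field_simp; ring

lemma CramerCondition.norm_complexCGF_le {Ω : Type*} [MeasurableSpace Ω] {μ : Measure Ω}
    [IsProbabilityMeasure μ] {X : Ω → ℝ} {H C : ℝ} (h : CramerCondition X μ H C) (hH : 0 < H)
    (hC : 0 < C) (hmean : ∫ ω, X ω ∂μ = 0) {w : ℂ} (hw : ‖w‖ ≤ H / 4) :
    ‖complexCGF X μ w‖ ≤ 32 * C / H ^ 2 * ‖w‖ ^ 2 := by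
  have h1 := h.hasSum_complexCGF (z := w) (by rw [mem_ball_zero_iff]; linarith)
  have h2 : HasSum (fun k : ℕ => 16 * C / H ^ 2 * ‖w‖ ^ 2 * (1 / 2 : ℝ) ^ k)
      (16 * C / H ^ 2 * ‖w‖ ^ 2 * 2) := hasSum_geometric_two.mul_left _
  rw [← h1.tsum_eq]
  refine (tsum_of_norm_bounded h2 fun k => h.norm_cumulant_term_le hH hC hmean hw k).trans
    (le_of_eq (by ring))

section IndepSum

variable {Ω ι : Type*} [MeasurableSpace Ω] {μ : Measure Ω} [IsProbabilityMeasure μ]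
  {ε : ι → Ω → ℝ} {H C c : ℝ} {b : ι → ℝ}

lemma integral_cexp_finset_sum (hmeas : ∀ i, Measurable (ε i)) (hindep : iIndepFun ε μ)
    (hcr : ∀ i, CramerCondition (ε i) μ H C) {z : ℂ} (hz : ∀ i, ‖z * b i‖ < H) (F : Finset ι) :
    ∫ ω, Complex.exp (z * ((∑ i ∈ F, b i * ε i ω : ℝ) : ℂ)) ∂μ
      = Complex.exp (∑ i ∈ F, complexCGF (ε i) μ (z * b i)) := by
  have hind : iIndepFun (fun i : F => ε i) μ := hindep.precomp Subtype.val_injective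
  have h1 := hind.integral_fun_prod_comp (𝕜 := ℂ) (X := fun i : F => ε i)
    (f := fun (i : F) (x : ℝ) => Complex.exp (z * b i * (x : ℂ)))
    (fun i => (hmeas i).aemeasurable)
    (fun i => Continuous.aestronglyMeasurable (by fun_prop))
  rw [Complex.exp_sum, ← Finset.prod_coe_sort F]
  have h2 : ∀ i : F, Complex.exp (complexCGF (ε i) μ (z * b i))
      = ∫ ω, Complex.exp (z * b i * (ε i ω : ℂ)) ∂μ := fun i => by
    rw [← (hcr i).complexMGF_eq_exp (by rw [mem_ball_zero_iff]; exact hz i)]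
    rfl
  simp_rw [h2]
  rw [← h1]
  congr 1 with ω
  rw [← Complex.exp_sum, Finset.sum_coe_sort F fun i => z * b i * (ε i ω : ℂ)]
  congr 1
  push_cast
  rw [Finset.mul_sum]
  refine Finset.sum_congr rfl fun i _ => by ring

lemma lintegral_exp_finset_sum_le (hmeas : ∀ i, Measurable (ε i)) (hindep : iIndepFun ε μ)
    (hH : 0 < H) (hC : 0 < C) (hcr : ∀ i, CramerCondition (ε i) μ H C)
    (hmean : ∀ i, ∫ ω, ε i ω ∂μ = 0) (hb : Summable fun i => b i ^ 2) {τ : ℝ}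
    (hτ : ∀ i, |τ * b i| ≤ H / 4) (F : Finset ι) :
    ∫⁻ ω, ENNReal.ofReal (Real.exp (τ * ∑ i ∈ F, b i * ε i ω)) ∂μ
      ≤ ENNReal.ofReal (Real.exp (32 * C / H ^ 2 * (τ ^ 2 * ∑' i, b i ^ 2))) := by
  have hint : Integrable (fun ω => Real.exp (τ * ∑ i ∈ F, b i * ε i ω)) μ := by
    have hind : iIndepFun (fun i ω => b i * ε i ω) μ :=
      hindep.comp (fun i x => b i * x) fun i => by fun_prop
    have := hind.integrable_exp_mul_sum (t := τ) (s := F) (fun i => (hmeas i).const_mul _)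
      (fun i _ => by
        have := (hcr i).integrable_exp_mul (t := τ * b i) (by linarith [hτ i])
        simpa [mul_assoc] using this)
    simpa using this
  rw [← ofReal_integral_eq_lintegral_ofReal hint (ae_of_all _ fun _ => (Real.exp_pos _).le)]
  refine ENNReal.ofReal_le_ofReal ?_
  have hz : ∀ i, ‖((τ : ℝ) : ℂ) * b i‖ ≤ H / 4 := fun i => by
    rw [← Complex.ofReal_mul, Complex.norm_real]; exact hτ i
  have h1 := integral_cexp_finset_sum (b := b) hmeas hindep hcr (z := τ)
    (fun i => by linarith [hz i]) F
  have h2 : ((∫ ω, Real.exp (τ * ∑ i ∈ F, b i * ε i ω) ∂μ : ℝ) : ℂ)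
      = Complex.exp (∑ i ∈ F, complexCGF (ε i) μ ((τ : ℂ) * b i)) := by
    rw [← h1, ← integral_complex_ofReal]
    congr 1 with ω
    push_cast
    rfl
  have h3 := congrArg norm h2
  rw [Complex.norm_real, Real.norm_of_nonneg (integral_nonneg fun _ => (Real.exp_pos _).le)] at h3
  rw [h3, Complex.norm_exp]
  refine Real.exp_le_exp.2 ((Complex.re_le_norm _).trans ((norm_sum_le _ _).trans ?_))
  calc ∑ i ∈ F, ‖complexCGF (ε i) μ ((τ : ℂ) * b i)‖
      ≤ ∑ i ∈ F, 32 * C / H ^ 2 * (τ ^ 2 * b i ^ 2) := by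
        refine Finset.sum_le_sum fun i _ => ?_
        refine ((hcr i).norm_complexCGF_le hH hC (hmean i) (hz i)).trans (le_of_eq ?_)
        rw [← Complex.ofReal_mul, Complex.norm_real, Real.norm_eq_abs, sq_abs, mul_pow]
    _ = 32 * C / H ^ 2 * (τ ^ 2 * ∑ i ∈ F, b i ^ 2) := by
        rw [Finset.mul_sum, Finset.mul_sum]
    _ ≤ _ := by
        gcongr
        exact hb.sum_le_tsum _ fun i _ => sq_nonneg _

/-- The moment generating function of an `L²`-convergent series of independent variables. -/
theorem integral_cexp_eq_of_tendsto_eLpNorm [Countable ι] (hmeas : ∀ i, Measurable (ε i))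
    (hindep : iIndepFun ε μ) (hH : 0 < H) (hC : 0 < C) (hcr : ∀ i, CramerCondition (ε i) μ H C)
    (hmean : ∀ i, ∫ ω, ε i ω ∂μ = 0) (hb : Summable fun i => b i ^ 2) {S : Ω → ℝ}
    (hS : AEStronglyMeasurable S μ)
    (hlim : Tendsto (fun F : Finset ι => eLpNorm ((fun ω => ∑ i ∈ F, b i * ε i ω) - S) 2 μ)
      atTop (𝓝 0)) {z : ℂ} (hz : ∀ i, ‖z * b i‖ ≤ H / 8) :
    Integrable (fun ω => Complex.exp (z * S ω)) μ ∧
      ∫ ω, Complex.exp (z * S ω) ∂μ = Complex.exp (∑' i, complexCGF (ε i) μ (z * b i)) := by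
  have hre : ∀ i, |z.re * b i| ≤ H / 8 := fun i => by
    refine le_trans ?_ (hz i)
    rw [norm_mul, Complex.norm_real, Real.norm_eq_abs, abs_mul]
    gcongr
    exact Complex.abs_re_le_norm z
  have hf : ∀ F : Finset ι, AEStronglyMeasurable (fun ω => ∑ i ∈ F, b i * ε i ω) μ := fun F =>
    (Finset.measurable_fun_sum F fun i _ => (hmeas i).const_mul _).aestronglyMeasurable
  -- Passing to the limit needs moments of twice the order, which is why `z b_i` is confined to
  -- radius `H / 8` rather than `H / 4`.
  have hK := fun F => lintegral_exp_finset_sum_le hmeas hindep hH hC hcr hmean hb (τ := 2 * z.re)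
    (fun i => by
      rw [mul_assoc, abs_mul, abs_two]
      linarith [hre i]) F
  have hK' := fun F => lintegral_exp_finset_sum_le hmeas hindep hH hC hcr hmean hb (τ := z.re)
    (fun i => by linarith [hre i]) F
  have hlimit := tendsto_integral_cexp hf hS hlim ENNReal.ofReal_ne_top ENNReal.ofReal_ne_top hK hK'
  have hKS' := lintegral_exp_le_of_tendsto_eLpNorm hf hS hlim hK'
  refine ⟨integrable_cexp_of_integrable_exp hS
    (integrable_exp_of_lintegral_le hS ENNReal.ofReal_ne_top hKS'), ?_⟩
  have hsummable : Summable fun i => complexCGF (ε i) μ (z * b i) := by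
    refine Summable.of_norm_bounded (g := fun i => 32 * C / H ^ 2 * ‖z‖ ^ 2 * b i ^ 2)
      (hb.mul_left _) fun i => ?_
    refine ((hcr i).norm_complexCGF_le hH hC (hmean i) (by linarith [hz i])).trans (le_of_eq ?_)
    rw [norm_mul, Complex.norm_real, Real.norm_eq_abs, mul_pow, sq_abs]
    ring
  refine tendsto_nhds_unique hlimit ?_
  have h1 : (fun F : Finset ι => ∫ ω, Complex.exp (z * ((∑ i ∈ F, b i * ε i ω : ℝ) : ℂ)) ∂μ)
      = fun F => Complex.exp (∑ i ∈ F, complexCGF (ε i) μ (z * b i)) :=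
    funext fun F => integral_cexp_finset_sum hmeas hindep hcr (fun i => by linarith [hz i]) F
  rw [h1]
  exact (Complex.continuous_exp.tendsto _).comp hsummable.hasSum

end IndepSum

/-! ### Normalized cumulants of a linear statistic -/

/-- The cumulants of the sum of independent centred variables with cumulants `c j k`, multiplied by
`H`, relative to the variance of this sum. -/
def normalizedCumulant {ι : Type*} (H : ℝ) (c : ι → ℕ → ℝ) : ℕ → ℝ
  -- The first three values are prescribed, so the normalization of the series holds by definition
  -- for every input.
  | 0 => 0
  | 1 => 0
  | 2 => 1
  | k + 3 => H ^ (k + 3) * (∑' j, c j (k + 3)) / (H ^ 2 * ∑' j, c j 2)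

section LinearStatistic

variable {Ω ι : Type*} [MeasurableSpace Ω] {μ : Measure Ω} [IsProbabilityMeasure μ]
  {ε : ι → Ω → ℝ} {H H₀ C₀ c₀ σ : ℝ} {b : ι → ℝ}

lemma tsum_cumulant_two (hmeas : ∀ i, Measurable (ε i)) (hH₀ : 0 < H₀)
    (hcr : ∀ i, CramerCondition (ε i) μ H₀ C₀) (hmean : ∀ i, ∫ ω, ε i ω ∂μ = 0)
    (hvar : ∀ i, variance (ε i) μ = σ ^ 2) :
    ∑' j, cumulant (fun ω => b j * ε j ω) μ 2 = σ ^ 2 * ∑' j, b j ^ 2 := by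
  rw [← tsum_mul_left]
  refine tsum_congr fun j => ?_
  rw [cumulant_const_mul, (hcr j).cumulant_two hH₀ (hmeas j).aemeasurable (hmean j), hvar, mul_comm]

lemma abs_mul_pow_le (hH : 0 < H) (hb : ∀ j, H * |b j| ≤ c₀) (j : ι) (k : ℕ) :
    |H * b j| ^ (k + 2) ≤ c₀ ^ k * (H ^ 2 * b j ^ 2) := by
  have h1 : |H * b j| ≤ c₀ := by rw [abs_mul, abs_of_pos hH]; exact hb j
  rw [pow_add, sq_abs, mul_pow]
  gcongr

/-- Two factors `H b_j` are kept for the variance and the others bounded by `c₀`. The variance then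
cancels, and the bound no longer involves `H` or `b`. The second summand of the constant serves `k =
2`. -/
lemma abs_normalizedCumulant_le (hmeas : ∀ i, Measurable (ε i)) (hH₀ : 0 < H₀) (hC₀ : 0 < C₀)
    (hcr : ∀ i, CramerCondition (ε i) μ H₀ C₀) (hmean : ∀ i, ∫ ω, ε i ω ∂μ = 0)
    (hvar : ∀ i, variance (ε i) μ = σ ^ 2) (hσ : σ ≠ 0) (hsum : Summable fun j => b j ^ 2)
    (hH : 0 < H) (hc₀ : 0 < c₀) (hb : ∀ j, H * |b j| ≤ c₀) (k : ℕ) :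
    |normalizedCumulant H (fun j k => cumulant (fun ω => b j * ε j ω) μ k) k| / k.factorial
      ≤ (C₀ / (σ ^ 2 * c₀ ^ 2) + 1 / (2 * c₀ / H₀) ^ 2) * (2 * c₀ / H₀) ^ k := by
  have hσ2 : 0 < σ ^ 2 := by positivity
  match k with
  | 0 => simp only [normalizedCumulant, abs_zero, zero_div]; positivity
  | 1 => simp only [normalizedCumulant, abs_zero, zero_div]; positivity
  | 2 =>
    simp only [normalizedCumulant]
    have h1 : 1 / (2 * c₀ / H₀) ^ 2 * (2 * c₀ / H₀) ^ 2 = 1 := by field_simp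
    have h2 : 0 ≤ C₀ / (σ ^ 2 * c₀ ^ 2) * (2 * c₀ / H₀) ^ 2 := by positivity
    rw [add_mul, h1]
    norm_num
    linarith
  | k + 3 =>
    simp only [normalizedCumulant]
    rw [tsum_cumulant_two hmeas hH₀ hcr hmean hvar]
    have hnorm : ∀ j, |H ^ (k + 3) * cumulant (fun ω => b j * ε j ω) μ (k + 3)|
        ≤ C₀ * (2 / H₀) ^ (k + 3) * (k + 3).factorial * (c₀ ^ (k + 1) * H ^ 2) * b j ^ 2 := by
      intro j
      have h1 := (hcr j).abs_cumulant_le hH₀ (k + 3)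
      rw [div_le_iff₀ (by positivity)] at h1
      rw [cumulant_const_mul, ← mul_assoc, ← mul_pow, abs_mul, abs_pow]
      calc |H * b j| ^ (k + 3) * |cumulant (ε j) μ (k + 3)|
          ≤ c₀ ^ (k + 1) * (H ^ 2 * b j ^ 2) * (C₀ * (2 / H₀) ^ (k + 3) * (k + 3).factorial) := by
            gcongr
            exact abs_mul_pow_le hH hb j (k + 1)
        _ = _ := by ring
    have hbd : |H ^ (k + 3) * ∑' j, cumulant (fun ω => b j * ε j ω) μ (k + 3)|
        ≤ C₀ * (2 / H₀) ^ (k + 3) * (k + 3).factorial * (c₀ ^ (k + 1) * H ^ 2) * ∑' j, b j ^ 2 := by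
      rw [← tsum_mul_left, ← tsum_mul_left, ← Real.norm_eq_abs]
      exact tsum_of_norm_bounded (hsum.mul_left _).hasSum hnorm
    have hS0 : 0 ≤ ∑' j, b j ^ 2 := tsum_nonneg fun j => sq_nonneg _
    rw [abs_div, abs_of_nonneg (by positivity : 0 ≤ H ^ 2 * (σ ^ 2 * ∑' j, b j ^ 2)), div_div]
    refine div_le_of_le_mul₀ (by positivity) (by positivity) (hbd.trans ?_)
    have h1 : C₀ * (2 / H₀) ^ (k + 3) * (k + 3).factorial * (c₀ ^ (k + 1) * H ^ 2) * ∑' j, b j ^ 2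
        = C₀ / (σ ^ 2 * c₀ ^ 2) * (2 * c₀ / H₀) ^ (k + 3) *
          (H ^ 2 * (σ ^ 2 * ∑' j, b j ^ 2) * (k + 3).factorial) := by
      rw [div_pow, div_pow, mul_pow]
      field_simp
      ring
    rw [h1]
    have h2 : 0 ≤ 1 / (2 * c₀ / H₀) ^ 2 := by positivity
    gcongr
    linarith

/-- The cumulant generating function of `H ∑ b_j ε_j` is the variance times the generating series of
the normalized cumulants. -/
lemma tsum_complexCGF_eq (hmeas : ∀ i, Measurable (ε i)) (hH₀ : 0 < H₀) (hC₀ : 0 < C₀)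
    (hcr : ∀ i, CramerCondition (ε i) μ H₀ C₀) (hmean : ∀ i, ∫ ω, ε i ω ∂μ = 0)
    (hvar : ∀ i, variance (ε i) μ = σ ^ 2) (hsum : Summable fun j => b j ^ 2)
    {z : ℂ} (hz : ∀ j, ‖z * ((H * b j : ℝ) : ℂ)‖ ≤ H₀ / 4)
    (hV : H ^ 2 * (σ ^ 2 * ∑' j, b j ^ 2) ≠ 0) :
    ∑' j, complexCGF (ε j) μ (z * ((H * b j : ℝ) : ℂ))
      = ((H ^ 2 * (σ ^ 2 * ∑' j, b j ^ 2) : ℝ) : ℂ) *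
        cumulantSeries (normalizedCumulant H fun j k => cumulant (fun ω => b j * ε j ω) μ k) z := by
  set T : ι → ℕ → ℂ := fun j k => ((cumulant (ε j) μ k / k.factorial : ℝ) : ℂ) *
    (z * ((H * b j : ℝ) : ℂ)) ^ k with hT
  have hTb : ∀ j k, ‖T j k‖ ≤ b j ^ 2 * (16 * C₀ / H₀ ^ 2 * (‖z‖ ^ 2 * H ^ 2) * (1 / 2) ^ k) := by
    intro j k
    refine ((hcr j).norm_cumulant_term_le hH₀ hC₀ (hmean j) (hz j) k).trans (le_of_eq ?_)
    rw [norm_mul, Complex.norm_real, Real.norm_eq_abs, mul_pow, sq_abs]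
    ring
  have hgeom : Summable fun k : ℕ => 16 * C₀ / H₀ ^ 2 * (‖z‖ ^ 2 * H ^ 2) * (1 / 2 : ℝ) ^ k :=
    (summable_geometric_of_lt_one (by norm_num) (by norm_num)).mul_left _
  -- The majorant is a product of `b_j²` and a geometric sequence, so the sums over `j` and over the
  -- order may be interchanged.
  have hTsum : Summable (Function.uncurry T) := by
    refine Summable.of_norm_bounded (hsum.mul_of_nonneg hgeom (fun j => sq_nonneg _)
      fun k => by positivity) ?_
    rintro ⟨j, k⟩
    exact hTb j k
  have h1 : ∀ j, complexCGF (ε j) μ (z * ((H * b j : ℝ) : ℂ)) = ∑' k, T j k := fun j =>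
    ((hcr j).hasSum_complexCGF (by rw [mem_ball_zero_iff]; linarith [hz j])).tsum_eq.symm
  simp_rw [h1]
  rw [← hTsum.tsum_comm, cumulantSeries, ← tsum_mul_left]
  refine tsum_congr fun k => ?_
  have h2 : ∀ j, T j k = ((H ^ k * cumulant (fun ω => b j * ε j ω) μ k : ℝ) : ℂ) *
      (z ^ k / k.factorial) := by
    intro j
    rw [hT, cumulant_const_mul]
    push_cast
    ring
  simp_rw [h2]
  rw [tsum_mul_right, ← Complex.ofReal_tsum, tsum_mul_left]
  have h3 : H ^ k * ∑' j, cumulant (fun ω => b j * ε j ω) μ k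
      = H ^ 2 * (σ ^ 2 * ∑' j, b j ^ 2) *
        normalizedCumulant H (fun j k => cumulant (fun ω => b j * ε j ω) μ k) k := by
    match k with
    | 0 => simp [normalizedCumulant, cumulant_zero]
    | 1 =>
      have : ∀ j, cumulant (fun ω => b j * ε j ω) μ 1 = 0 := fun j => by
        rw [cumulant_const_mul, (hcr j).cumulant_one hH₀ (hmean j), mul_zero]
      simp [normalizedCumulant, this]
    | 2 => simp only [normalizedCumulant]; rw [tsum_cumulant_two hmeas hH₀ hcr hmean hvar, mul_one]
    | k + 3 =>
      simp only [normalizedCumulant]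
      rw [tsum_cumulant_two hmeas hH₀ hcr hmean hvar, mul_div_cancel₀ _ hV]
  rw [h3]
  push_cast
  ring

/-- The law of `H ∑ b_j ε_j` has cumulant generating function `V φ`, where `V` is its variance and
`φ` is the generating series of the normalized cumulants. -/
lemma hasCGFOnBall_map [Countable ι] (hmeas : ∀ i, Measurable (ε i)) (hindep : iIndepFun ε μ)
    (hH₀ : 0 < H₀) (hC₀ : 0 < C₀) (hcr : ∀ i, CramerCondition (ε i) μ H₀ C₀)
    (hmean : ∀ i, ∫ ω, ε i ω ∂μ = 0) (hvar : ∀ i, variance (ε i) μ = σ ^ 2)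
    (hsum : Summable fun j => b j ^ 2) (hH : 0 < H) (hc₀ : 0 < c₀) (hb : ∀ j, H * |b j| ≤ c₀)
    (hV : H ^ 2 * (σ ^ 2 * ∑' j, b j ^ 2) ≠ 0) {S : Ω → ℝ} (hS : AEStronglyMeasurable S μ)
    (hlim : Tendsto (fun F : Finset ι => eLpNorm ((fun ω => ∑ i ∈ F, b i * ε i ω) - S) 2 μ)
      atTop (𝓝 0)) :
    HasCGFOnBall (μ.map fun ω => H * S ω) (H ^ 2 * (σ ^ 2 * ∑' j, b j ^ 2))
      (cumulantSeries (normalizedCumulant H fun j k => cumulant (fun ω => b j * ε j ω) μ k))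
      (1 / (4 * (2 * c₀ / H₀))) := by
  intro z hz
  rw [mem_ball_zero_iff] at hz
  have hz8 : ∀ j, ‖z * ((H * b j : ℝ) : ℂ)‖ ≤ H₀ / 8 := by
    intro j
    rw [norm_mul, Complex.norm_real, Real.norm_eq_abs, abs_mul, abs_of_pos hH]
    calc ‖z‖ * (H * |b j|) ≤ 1 / (4 * (2 * c₀ / H₀)) * c₀ := by
          gcongr
          exact hb j
      _ = H₀ / 8 := by field_simp; norm_num
  have hSm : AEStronglyMeasurable (fun ω => H * S ω) μ := hS.const_mul H
  have hlim' : Tendsto (fun F : Finset ι =>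
      eLpNorm ((fun ω => ∑ i ∈ F, (H * b i) * ε i ω) - fun ω => H * S ω) 2 μ) atTop (𝓝 0) := by
    have h1 : ∀ F : Finset ι, eLpNorm ((fun ω => ∑ i ∈ F, (H * b i) * ε i ω) - fun ω => H * S ω) 2 μ
        = ‖H‖ₑ * eLpNorm ((fun ω => ∑ i ∈ F, b i * ε i ω) - S) 2 μ := by
      intro F
      rw [← eLpNorm_const_smul]
      congr 1
      ext ω
      simp only [Pi.sub_apply, Pi.smul_apply, smul_eq_mul, mul_sub, Finset.mul_sum, mul_assoc]
    simp_rw [h1]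
    have := ENNReal.Tendsto.const_mul (a := ‖H‖ₑ) hlim (Or.inr enorm_ne_top)
    simpa using this
  have key := integral_cexp_eq_of_tendsto_eLpNorm (b := fun i => H * b i) hmeas hindep hH₀ hC₀ hcr
    hmean (by simpa [mul_pow] using hsum.mul_left (H ^ 2)) hSm hlim' hz8
  have hcont : Continuous fun x : ℝ => Complex.exp (z * x) := by fun_prop
  constructor
  · rw [integrable_map_measure hcont.aestronglyMeasurable hSm.aemeasurable]
    exact key.1
  · rw [integral_map hSm.aemeasurable hcont.aestronglyMeasurable, key.2,
      tsum_complexCGF_eq hmeas hH₀ hC₀ hcr hmean hvar hsum (fun j => by linarith [hz8 j]) hV]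

end LinearStatistic

/-! ### Square-summable combinations of independent variables -/

section L2Series

variable {Ω ι : Type*} [MeasurableSpace Ω] {μ : Measure Ω} {ε : ι → Ω → ℝ} {σ : ℝ}

lemma inner_toLp_eq (hL2 : ∀ i, MemLp (ε i) 2 μ) (i j : ι) :
    inner ℝ ((hL2 i).toLp (ε i)) ((hL2 j).toLp (ε j)) = ∫ ω, ε i ω * ε j ω ∂μ := by
  rw [L2.inner_def]
  refine integral_congr_ae ?_
  filter_upwards [(hL2 i).coeFn_toLp, (hL2 j).coeFn_toLp] with ω h1 h2
  rw [h1, h2]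
  simp [mul_comm]

lemma orthonormal_toLp [IsProbabilityMeasure μ] (hL2 : ∀ i, MemLp (ε i) 2 μ)
    (hindep : iIndepFun ε μ)
    (hmean : ∀ i, ∫ ω, ε i ω ∂μ = 0) (hvar : ∀ i, variance (ε i) μ = σ ^ 2) (hσ : σ ≠ 0) :
    Orthonormal ℝ fun i => σ⁻¹ • (hL2 i).toLp (ε i) := by
  classical
  rw [orthonormal_iff_ite]
  intro i j
  rw [inner_smul_left, inner_smul_right, inner_toLp_eq]
  split_ifs with hij
  · subst hij
    have h1 := hvar i
    rw [variance_of_integral_eq_zero (hL2 i).1.aemeasurable (hmean i)] at h1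
    simp_rw [← sq, h1]
    simp
    field_simp
  · rw [(hindep.indepFun hij).integral_fun_mul_eq_mul_integral (hL2 i).1 (hL2 j).1, hmean i]
    simp

lemma summable_smul_toLp [IsProbabilityMeasure μ] (hL2 : ∀ i, MemLp (ε i) 2 μ)
    (hindep : iIndepFun ε μ)
    (hmean : ∀ i, ∫ ω, ε i ω ∂μ = 0) (hvar : ∀ i, variance (ε i) μ = σ ^ 2) (hσ : σ ≠ 0)
    {c : ι → ℝ} (hc : Summable fun i => c i ^ 2) :
    Summable fun i => c i • (hL2 i).toLp (ε i) := by
  have h1 := (orthonormal_toLp hL2 hindep hmean hvar hσ).orthogonalFamily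
  have h2 := (h1.summable_iff_norm_sq_summable fun i => σ * c i).2 (by
    simpa [mul_pow] using hc.mul_left (σ ^ 2))
  refine h2.congr fun i => ?_
  rw [LinearIsometry.toSpanSingleton_apply, smul_smul]
  congr 1
  field_simp

lemma coeFn_finset_sum_smul_toLp (hL2 : ∀ i, MemLp (ε i) 2 μ) (c : ι → ℝ) (F : Finset ι) :
    ((∑ i ∈ F, c i • (hL2 i).toLp (ε i) : Lp ℝ 2 μ) : Ω → ℝ) =ᵐ[μ]
      fun ω => ∑ i ∈ F, c i * ε i ω := by
  classical
  induction F using Finset.induction_on with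
  | empty =>
    simp only [Finset.sum_empty]
    exact Lp.coeFn_zero ℝ 2 μ
  | insert i F hi ih =>
    simp only [Finset.sum_insert hi]
    filter_upwards [ih, Lp.coeFn_add (c i • (hL2 i).toLp (ε i))
      (∑ i ∈ F, c i • (hL2 i).toLp (ε i)), Lp.coeFn_smul (c i) ((hL2 i).toLp (ε i)),
      (hL2 i).coeFn_toLp] with ω h1 h2 h3 h4
    rw [h2, Pi.add_apply, h1, h3, Pi.smul_apply, h4, smul_eq_mul]

lemma tendsto_eLpNorm_of_hasSum (hL2 : ∀ i, MemLp (ε i) 2 μ) {c : ι → ℝ} {S : Lp ℝ 2 μ}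
    (h : HasSum (fun i => c i • (hL2 i).toLp (ε i)) S) :
    Tendsto (fun F : Finset ι => eLpNorm ((fun ω => ∑ i ∈ F, c i * ε i ω) - (S : Ω → ℝ)) 2 μ)
      atTop (𝓝 0) := by
  refine ((Lp.tendsto_Lp_iff_tendsto_eLpNorm' _ _).1 h).congr fun F => ?_
  exact eLpNorm_congr_ae ((coeFn_finset_sum_smul_toLp hL2 c F).sub (ae_eq_refl _))

/-- On a finite measure space the mean is the inner product with the constant `1`, hence continuous
on `L²`. -/
lemma integral_eq_zero_of_hasSum [IsFiniteMeasure μ] (hL2 : ∀ i, MemLp (ε i) 2 μ)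
    (hmean : ∀ i, ∫ ω, ε i ω ∂μ = 0)
    {c : ι → ℝ} {S : Lp ℝ 2 μ} (h : HasSum (fun i => c i • (hL2 i).toLp (ε i)) S) :
    ∫ ω, (S : Ω → ℝ) ω ∂μ = 0 := by
  have hint : ∀ f : Lp ℝ 2 μ,
      inner ℝ (indicatorConstLp 2 MeasurableSet.univ (measure_ne_top μ _) (1 : ℝ)) f
        = ∫ ω, (f : Ω → ℝ) ω ∂μ := fun f => by
    rw [L2.inner_indicatorConstLp_one, setIntegral_univ]
  have h1 := h.mapL (innerSL ℝ (indicatorConstLp 2 MeasurableSet.univ (measure_ne_top μ _) (1 : ℝ)))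
  simp only [innerSL_apply_apply, inner_smul_right] at h1
  have h2 : ∀ i, ∫ ω, ((hL2 i).toLp (ε i) : Ω → ℝ) ω ∂μ = 0 := fun i => by
    rw [integral_congr_ae (hL2 i).coeFn_toLp, hmean i]
  simp only [hint, h2, mul_zero] at h1
  exact h1.unique hasSum_zero

end L2Series

/-! ### The kernel estimator as a linear statistic -/

section Estimator

variable {d m : ℕ} {Ω : Type*} [MeasurableSpace Ω] {μ : Measure Ω}
  {K : EuclideanSpace ℝ (Fin m) → ℝ} {h : ℕ → ℝ}
  {pt : ℕ → (Fin d → ℤ) → EuclideanSpace ℝ (Fin m)} {a : (Fin d → ℤ) → ℝ}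

lemma summable_coeff_sq (ha : Summable fun i => a i ^ 2) (n : ℕ) (z : EuclideanSpace ℝ (Fin m)) :
    Summable fun j => coeff K h pt a n j z ^ 2 := by
  have h1 : Summable fun j : Fin d → ℤ =>
      ((box d n).card : ℝ) * ∑ i ∈ box d n, (weight K h pt n i z * a (i - j)) ^ 2 := by
    refine Summable.mul_left _ (summable_sum fun i _ => ?_)
    simp_rw [mul_pow]
    exact ((Equiv.subLeft i).summable_iff.2 ha).mul_left _
  refine h1.of_nonneg_of_le (fun j => sq_nonneg _) fun j => ?_
  exact sq_sum_le_card_mul_sum_sq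

/-- Square summability bounds the coefficients, without which the real supremum would be the default
value `0`. -/
lemma abs_coeff_le_maxM (ha : Summable fun i => a i ^ 2) (n : ℕ) (j : Fin d → ℤ)
    (z : EuclideanSpace ℝ (Fin m)) : |coeff K h pt a n j z| ≤ maxM K h pt a n z := by
  refine le_ciSup (f := fun j => |coeff K h pt a n j z|) ?_ j
  refine ⟨√(∑' j, coeff K h pt a n j z ^ 2), ?_⟩
  rintro _ ⟨j, rfl⟩
  refine Real.abs_le_sqrt ?_
  exact (summable_coeff_sq ha n z).le_tsum j fun i _ => sq_nonneg _

/-- The centred estimator is almost surely the linear statistic `∑ b_{n,j}(z) ε_{n,j}`. -/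
lemma exists_hasSum_coeff_smul [IsProbabilityMeasure μ] {ε : (Fin d → ℤ) → Ω → ℝ} {σ : ℝ}
    (hL2 : ∀ i, MemLp (ε i) 2 μ) (hindep : iIndepFun ε μ) (hmean : ∀ i, ∫ ω, ε i ω ∂μ = 0)
    (hvar : ∀ i, variance (ε i) μ = σ ^ 2) (hσ : σ ≠ 0) (ha : Summable fun i => a i ^ 2)
    {g : EuclideanSpace ℝ (Fin m) → ℝ} {Y : ℕ → (Fin d → ℤ) → Ω → ℝ} (n : ℕ)
    (hY : ∀ j ∈ box d n, ∀ ω, Y n j ω = g (pt n j) + linearField μ a ε hL2 j ω)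
    (z : EuclideanSpace ℝ (Fin m)) :
    ∃ S : Lp ℝ 2 μ, HasSum (fun j => coeff K h pt a n j z • (hL2 j).toLp (ε j)) S ∧
      ∀ᵐ ω ∂μ, estimator K h pt Y n z ω - ∫ ω', estimator K h pt Y n z ω' ∂μ
        = (S : Ω → ℝ) ω := by
  set X : (Fin d → ℤ) → Lp ℝ 2 μ := fun j => ∑' i, a i • (hL2 (j - i)).toLp (ε (j - i)) with hX
  have hXsum : ∀ j, HasSum (fun k => a (j - k) • (hL2 k).toLp (ε k)) (X j) := by
    intro j
    have h1 : Summable fun k => a (j - k) • (hL2 k).toLp (ε k) :=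
      summable_smul_toLp hL2 hindep hmean hvar hσ ((Equiv.subLeft j).summable_iff.2 ha)
    -- The substitution `k = j - i` indexes every field value by the same innovations, so finite
    -- combinations can be collected termwise.
    have h2 : X j = ∑' k, a (j - k) • (hL2 k).toLp (ε k) := by
      rw [hX, ← (Equiv.subLeft j).tsum_eq]
      refine tsum_congr fun i => ?_
      simp only [Equiv.subLeft_apply, sub_sub_cancel]
    rw [h2]
    exact h1.hasSum
  set S : Lp ℝ 2 μ := ∑ j ∈ box d n, weight K h pt n j z • X j with hS
  have hSsum : HasSum (fun k => coeff K h pt a n k z • (hL2 k).toLp (ε k)) S := by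
    have h1 := hasSum_sum (s := box d n) fun j _ => (hXsum j).const_smul (weight K h pt n j z)
    refine h1.congr_fun fun k => ?_
    simp only [coeff, Finset.sum_smul, smul_smul]
  have hScoe : ∀ᵐ ω ∂μ, (S : Ω → ℝ) ω = ∑ j ∈ box d n, weight K h pt n j z * (X j : Ω → ℝ) ω := by
    have h1 := coeFn_finset_sum_smul_toLp (μ := μ) (ε := fun j => (X j : Ω → ℝ))
      (fun j => Lp.memLp (X j)) (fun j => weight K h pt n j z) (box d n)
    simp only [Lp.toLp_coeFn] at h1
    exact h1
  set G : ℝ := ∑ j ∈ box d n, weight K h pt n j z * g (pt n j) with hG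
  have hest : ∀ᵐ ω ∂μ, estimator K h pt Y n z ω = G + (S : Ω → ℝ) ω := by
    filter_upwards [hScoe] with ω hω
    rw [hω, estimator, hG, ← Finset.sum_add_distrib]
    refine Finset.sum_congr rfl fun j hj => ?_
    rw [hY j hj ω, mul_add]
    rfl
  have hSint : Integrable (S : Ω → ℝ) μ := (Lp.memLp S).integrable one_le_two
  refine ⟨S, hSsum, ?_⟩
  have hmeanE : ∫ ω, estimator K h pt Y n z ω ∂μ = G := by
    rw [integral_congr_ae hest, integral_add (integrable_const _) hSint,
      integral_eq_zero_of_hasSum hL2 hmean hSsum]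
    simp
  filter_upwards [hest] with ω hω
  rw [hmeanE, hω, add_sub_cancel_left]

end Estimator

/-- A Cramér expansion for `ν` in terms of the scale `H √B`, with `ν` the law of a multiple
`H S` of a random variable `S` of variance `B`. -/
lemma tail_eq_of_abs_div_sub_one_le {Ω : Type*} [MeasurableSpace Ω] {μ : Measure Ω} {S E : Ω → ℝ}
    (hS : AEMeasurable S μ) (hES : ∀ᵐ ω ∂μ, E ω = S ω) {H B x D : ℝ} {b : ℕ → ℝ} (hH : 0 < H)
    (hB : 0 < B)
    (h : |(μ.map fun ω => H * S ω).real (Set.Ioi (x / (H * √B) * (H ^ 2 * B))) /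
      ((1 - stdNormalCDF (x / (H * √B) * √(H ^ 2 * B))) * Real.exp (H ^ 2 * B *
        ((x / (H * √B)) ^ 3 * ∑' k, b k * (x / (H * √B)) ^ k))) - 1| ≤
      D * (x / (H * √B) + 1 / √(H ^ 2 * B))) :
    ∃ r : ℝ, |r| ≤ D * ((x + 1) / (H * √B)) ∧
      μ.real {ω | E ω > x * √B} = (1 - stdNormalCDF x) *
        Real.exp (x ^ 3 / (H * √B) * ∑' k, b k * (x / (H * √B)) ^ k) * (1 + r) := by
  have hsB : 0 < √B := Real.sqrt_pos.2 hB
  have hBsq : √B * √B = B := Real.mul_self_sqrt hB.le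
  have e1 : √(H ^ 2 * B) = H * √B := by
    rw [Real.sqrt_mul (sq_nonneg H), Real.sqrt_sq hH.le]
  have e2 : x / (H * √B) * (H * √B) = x := by field_simp
  have e3 : x / (H * √B) * (H ^ 2 * B) = H * (x * √B) := by
    nth_rw 2 [← hBsq]
    field_simp
  have e4 : ∀ s : ℝ, H ^ 2 * B * ((x / (H * √B)) ^ 3 * s) = x ^ 3 / (H * √B) * s := by
    intro s
    nth_rw 1 [← hBsq]
    field_simp
  have e5 : x / (H * √B) + 1 / (H * √B) = (x + 1) / (H * √B) := by rw [add_div]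
  rw [e1, e2, e3, e4, e5] at h
  have e6 : (μ.map fun ω => H * S ω).real (Set.Ioi (H * (x * √B))) =
      μ.real {ω | E ω > x * √B} := by
    rw [map_measureReal_apply_of_aemeasurable (hS.const_mul H) measurableSet_Ioi]
    refine measureReal_congr ?_
    filter_upwards [hES] with ω hω
    refine propext ?_
    change H * (x * √B) < H * S ω ↔ E ω > x * √B
    rw [hω, mul_lt_mul_iff_right₀ hH]
  rw [e6] at h
  refine ⟨_, h, ?_⟩
  have h1 := one_sub_stdNormalCDF_pos x
  have h2 := Real.exp_pos (x ^ 3 / (H * √B) * ∑' k, b k * (x / (H * √B)) ^ k)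
  rw [add_sub_cancel, mul_div_cancel₀ _ (mul_pos h1 h2).ne']

end KernelRegression

end

/-! ### The main theorem -/

open KernelRegression in
theorem mainTheorem7 (d : ℕ) :
    -- `β_{kn} = Λ H_n (cumulants of b_{n,j}(z) ε_{n,j}, j ∈ ℤ^d) k`, one `Λ` for all models
    ∃ Λ : ℝ → ((Fin d → ℤ) → ℕ → ℝ) → ℕ → ℝ,
    ∀ (m : ℕ) {Ω : Type*} [MeasurableSpace Ω] (μ : Measure Ω) [IsProbabilityMeasure μ]
      -- innovations
      (ε : ℕ → (Fin d → ℤ) → Ω → ℝ) (σ H₀ C₀ : ℝ)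
      (_hmeas : ∀ n i, Measurable (ε n i))
      (hL2 : ∀ n i, MemLp (ε n i) 2 μ)
      (_hindep : ∀ n, iIndepFun (ε n) μ)
      (_hident : ∀ n i j, IdentDistrib (ε n i) (ε n j) μ μ)
      (_hmean : ∀ n i, ∫ ω, ε n i ω ∂μ = 0)
      (_hvar : ∀ n i, variance (ε n i) μ = σ ^ 2)
      (_hH₀ : 0 < H₀) (_hC₀ : 0 < C₀)
      (_hcramer : ∀ n i, CramerCondition (ε n i) μ H₀ C₀)
      -- coefficients of the linear random field
      (a : (Fin d → ℤ) → ℝ) (_ha : Summable (fun i => a i ^ 2))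
      -- regression function, design points, kernel and bandwidths
      (g : EuclideanSpace ℝ (Fin m) → ℝ) (_hgc : Continuous g) (_hgb : ∃ D, ∀ u, |g u| ≤ D)
      (pt : ℕ → (Fin d → ℤ) → EuclideanSpace ℝ (Fin m))
      (_hpt : ∃ T : Set (EuclideanSpace ℝ (Fin m)), IsCompact T ∧ ∀ n, ∀ j ∈ box d n, pt n j ∈ T)
      (K : EuclideanSpace ℝ (Fin m) → ℝ) (_hK : ∀ u, 0 ≤ K u)
      (h : ℕ → ℝ) (_hh : ∀ n, 0 < h n) (_hh0 : Tendsto h atTop (𝓝 0))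
      -- observations
      (Y : ℕ → (Fin d → ℤ) → Ω → ℝ)
      (_hY : ∀ n, ∀ j ∈ box d n, ∀ ω, Y n j ω = g (pt n j) + linearField μ a (ε n) (hL2 n) j ω)
      -- the point of estimation and the normalizing sequence
      (z : EuclideanSpace ℝ (Fin m))
      (H : ℕ → ℝ) (_hH : ∀ n, 0 < H n)
      (_hHM : IsPropTo H (fun n => (maxM K h pt a n z)⁻¹))
      (_hBH : Tendsto (fun n => varB K h pt a σ n z * H n ^ 2) atTop atTop)
      (β : ℕ → ℕ → ℝ)
      (_hβ : ∀ n, β n =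
        Λ (H n) (fun j k => cumulant (fun ω => coeff K h pt a n j z * ε n j ω) μ k)),
      -- the power series `∑ β_{kn} t^k` are uniformly bounded near `0`
      (∃ ρ > 0, ∃ D : ℝ, ∀ n, ∀ t : ℂ, ‖t‖ < ρ →
        Summable (fun k => (β n k : ℂ) * t ^ k) ∧ ‖∑' k, (β n k : ℂ) * t ^ k‖ ≤ D) ∧
      -- the expansion, with a constant `D` that does not depend on the sequence `x`
      ∃ D : ℝ, ∀ x : ℕ → ℝ, (∀ n, 0 ≤ x n) →
        x =o[atTop] (fun n => H n * √(varB K h pt a σ n z)) →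
        ∃ r : ℕ → ℝ, ∀ᶠ n in atTop,
          |r n| ≤ D * ((x n + 1) / (H n * √(varB K h pt a σ n z))) ∧
          μ.real {ω | estimator K h pt Y n z ω - ∫ ω', estimator K h pt Y n z ω' ∂μ
              > x n * √(varB K h pt a σ n z)} =
            (1 - stdNormalCDF (x n)) *
            Real.exp (x n ^ 3 / (H n * √(varB K h pt a σ n z)) *
              ∑' k, β n k * (x n / (H n * √(varB K h pt a σ n z))) ^ k) *
            (1 + r n) := by
  refine ⟨fun H c => cramerCoeff (cumulantSeries (normalizedCumulant H c)), ?_⟩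
  intro m Ω _ μ _ ε σ H₀ C₀ hmeas hL2 hindep _ hmean hvar hH₀ hC₀ hcr a ha g _ _ pt _ K _ h _ _ Y hY
    z H hH hHM hBH β hβ
  -- If `σ = 0`, then `B_n = 0` for all `n`, contradicting `B_n H_n² → ∞`.
  have hσ : σ ≠ 0 := by
    rintro rfl
    obtain ⟨n, hn⟩ := (hBH.eventually_gt_atTop 0).exists
    simp [varB] at hn
  -- A convergent sequence is bounded over all `n`; only boundedness of `H_n M_n` is used. The
  -- maximum with `1` ensures positivity.
  obtain ⟨c₀, hc₀, hb⟩ : ∃ c₀ > 0, ∀ n j, H n * |coeff K h pt a n j z| ≤ c₀ := by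
    obtain ⟨c, _, hc⟩ := hHM
    obtain ⟨C, hC⟩ := hc.bddAbove_range
    refine ⟨max C 1, by positivity, fun n j => le_max_of_le_left ?_⟩
    have h1 : H n / (maxM K h pt a n z)⁻¹ ≤ C := hC ⟨n, rfl⟩
    rw [div_inv_eq_mul] at h1
    exact (mul_le_mul_of_nonneg_left (abs_coeff_le_maxM ha n j z) (hH n).le).trans h1
  have hq : 0 < 2 * c₀ / H₀ := by positivity
  set c : ℕ → (Fin d → ℤ) → ℕ → ℝ := fun n j k =>
    cumulant (fun ω => coeff K h pt a n j z * ε n j ω) μ k with hc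
  set φ : ℕ → ℂ → ℂ := fun n => cumulantSeries (normalizedCumulant (H n) (c n)) with hφ
  have hnorm : ∀ n, IsNormalizedCGF (φ n) (1 / (4 * (2 * c₀ / H₀)))
      (12 * (C₀ / (σ ^ 2 * c₀ ^ 2) + 1 / (2 * c₀ / H₀) ^ 2) / (1 / (8 * (2 * c₀ / H₀))) ^ 3) :=
    fun n => isNormalizedCGF_cumulantSeries hq rfl rfl rfl fun k =>
      abs_normalizedCumulant_le (hmeas n) hH₀ hC₀ (hcr n) (hmean n) (hvar n) hσ
        (summable_coeff_sq ha n z) (hH n) hc₀ (hb n) k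
  have hR : 0 < 1 / (4 * (2 * c₀ / H₀)) := by positivity
  have hA : 0 < 12 * (C₀ / (σ ^ 2 * c₀ ^ 2) + 1 / (2 * c₀ / H₀) ^ 2) /
      (1 / (8 * (2 * c₀ / H₀))) ^ 3 := by positivity
  constructor
  · obtain ⟨ρ, hρ, D, hD⟩ := exists_cramerSeries hR hA
    refine ⟨ρ, hρ, D, fun n t ht => ?_⟩
    rw [hβ n]
    exact (hD (φ n) (hnorm n)).1 t ht
  · obtain ⟨δ, hδ, D, hD⟩ := exists_cramer_expansion hR hA
    refine ⟨D, fun x hx hxo => ?_⟩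
    suffices hev : ∀ᶠ n in atTop, ∃ r : ℝ, |r| ≤ D * ((x n + 1) / (H n * √(varB K h pt a σ n z))) ∧
        μ.real {ω | estimator K h pt Y n z ω - ∫ ω', estimator K h pt Y n z ω' ∂μ
            > x n * √(varB K h pt a σ n z)} =
          (1 - stdNormalCDF (x n)) *
          Real.exp (x n ^ 3 / (H n * √(varB K h pt a σ n z)) *
            ∑' k, β n k * (x n / (H n * √(varB K h pt a σ n z))) ^ k) * (1 + r) from hev.choice
    -- The hypothesis on `x` only serves to bring `y = x / (H √B)` below the fixed `δ`; this affects
    -- from which `n` the estimate holds, not the constant `D`.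
    filter_upwards [hBH.eventually_gt_atTop 0, hxo.def (half_pos hδ)] with n hn hxn
    have hB : 0 < varB K h pt a σ n z := pos_of_mul_pos_left hn (sq_nonneg _)
    have hHB : 0 < H n * √(varB K h pt a σ n z) := mul_pos (hH n) (Real.sqrt_pos.2 hB)
    rw [Real.norm_of_nonneg (hx n), Real.norm_of_nonneg hHB.le] at hxn
    have hV : 0 < H n ^ 2 * varB K h pt a σ n z := by rwa [mul_comm]
    obtain ⟨S, hS, hES⟩ := exists_hasSum_coeff_smul (K := K) (h := h) (hL2 n) (hindep n) (hmean n)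
      (hvar n) hσ ha n (hY n) z
    have hSm : AEStronglyMeasurable (S : Ω → ℝ) μ := (Lp.memLp S).1
    have : IsProbabilityMeasure (μ.map fun ω => H n * (S : Ω → ℝ) ω) :=
      Measure.isProbabilityMeasure_map (hSm.aemeasurable.const_mul _)
    have hcgf : HasCGFOnBall (μ.map fun ω => H n * (S : Ω → ℝ) ω)
        (H n ^ 2 * varB K h pt a σ n z) (φ n) (1 / (4 * (2 * c₀ / H₀))) :=
      hasCGFOnBall_map (hmeas n) (hindep n) hH₀ hC₀ (hcr n) (hmean n) (hvar n)
        (summable_coeff_sq ha n z) (hH n) hc₀ (hb n) hV.ne' hSm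
        (tendsto_eLpNorm_of_hasSum (hL2 n) hS)
    have hy : x n / (H n * √(varB K h pt a σ n z)) < δ := by
      rw [div_lt_iff₀ hHB]
      nlinarith
    rw [hβ n]
    exact tail_eq_of_abs_div_sub_one_le hSm.aemeasurable hES (hH n) hB
      (hD (φ n) (hnorm n) _ _ hV hcgf _ (div_nonneg (hx n) hHB.le) hy)
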